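/- Let $k$ be a perfect field of characteristic different from $2$, let $\overline k$ be an algebraic closure of $k$ and $G_k=\operatorname{Gal}(\overline k/k)$. For a set $X$ with an action of $G_k$, its field of definition is the fixed field in $\overline k$ of the kernel of the action. $H^1$ denotes continuous cohomology with discrete coefficients. For $d\in k^*$ let $\kappa(d)\in H^1(G_k,\{\pm1\})$ be the class of $\sigma\mapsto{}^\sigma\!\sqrt d/\sqrt d$. Let $A\subset\operatorname{GL}_2(\overline k)$ be a subgroup stable under the entrywise action of $G_k$, and put $A'=A/\{\pm1\}$ (with $\{\pm1\}$ the scalar matrices $\pm 1$, which lie in $A$ in both cases below). Let $\delta:A'^{G_k}\to H^1(G_k,\{\pm1\})$ be the connecting homomorphism of $1\to\{\pm1\}\to A\to A'\to1$, sending the class of $a\in A$ to the class of $\sigma\mapsto a^{-1}\,{}^\sigma a$. The group of hyperelliptic twists is $H^1(G_k,\{\pm1\})/\delta(A'^{G_k})$. Let $K$ be the field of definition of $A$. For $S\subset k^*$ let $\langle k^{*2},S\rangle$ be the subgroup of $k^*$ generated by the squares and $S$. (1) Suppose $A\simeq D_8=\langle U,V\mid U^2=V^4=1,\ VU=UV^3\rangle$.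 Let $K_1$ and $K_2$ be the fields of definition of the induced actions on $A'$ and on $\langle V\rangle$. Then $K_2=k(\sqrt v)$ for some $v\in k^*$; and, for every such $v$, if $K_1=k$ then $K=k(\sqrt v,\sqrt m)$ for some $m\in k^*$. For all such $v$ and $m$, $\kappa$ induces an isomorphism $$H^1(G_k,\{\pm1\})/\delta(A'^{G_k})\simeq\begin{cases}k^*/\langle k^{*2},v,m\rangle,&\text{if }K_1=k,\\ k^*/\langle k^{*2},v\rangle,&\text{if }K_1\ne k.\end{cases}$$ (2) Suppose that the characteristic of $k$ is also different from $3$ and $A\simeq D_{12}=\langle U,V\mid U^2=V^6=1,\ VU=UV^5\rangle$. Let $K_1$ be the field of definition of the induced action on $A/\langle V^2\rangle$. Then $K_1=k(\sqrt u)$ for some $u\in k^*$, and for every such $u$, $\kappa$ induces an isomorphism $$H^1(G_k,\{\pm1\})/\delta(A'^{G_k})\simeq\begin{cases}k^*/\langle k^{*2},u\rangle,&\text{if }3\nmid[K:k],\\ k^*/k^{*2},&\text{if }3\mid[K:k].\end{cases}$$ -/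

import Mathlib

/-! ### Groups with an action of a group `G` by automorphisms -/

/-- A subgroup stable under the action of `G` (a sub-`G`-group). -/
class IsGStable (G : Type*) {B : Type*} [Group G] [Group B] [MulDistribMulAction G B]
    (A : Subgroup B) : Prop where
  smul_mem : ∀ (g : G) {b : B}, b ∈ A → g • b ∈ A

section GGroups

variable {G B : Type*} [Group G] [Group B] [MulDistribMulAction G B]

/-- The action of `G` on a `G`-stable subgroup. -/
instance IsGStable.instMulDistribMulAction (A : Subgroup B) [IsGStable G A] :
    MulDistribMulAction G A where
  smul g a := ⟨g • (a : B), IsGStable.smul_mem g a.2⟩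
  one_smul a := Subtype.ext (one_smul G (a : B))
  mul_smul g h a := Subtype.ext (mul_smul g h (a : B))
  smul_mul g a b := Subtype.ext (smul_mul' g (a : B) (b : B))
  smul_one g := Subtype.ext (smul_one g)

theorem IsGStable.coe_smul (A : Subgroup B) [IsGStable G A] (g : G) (a : A) :
    ((g • a : A) : B) = g • (a : B) := rfl

/-- Characteristic subgroups are stable under every action by automorphisms. -/
instance IsGStable.of_characteristic (S : Subgroup B) [hS : S.Characteristic] :
    IsGStable G S where
  smul_mem g b hb := by
    have h := hS.fixed (MulDistribMulAction.toMulEquiv B g)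
    rw [← h] at hb
    simpa using hb

instance IsGStable.subgroupOf (A S : Subgroup B) [IsGStable G A] [IsGStable G S] :
    IsGStable G (S.subgroupOf A) where
  smul_mem g b hb := by
    rw [Subgroup.mem_subgroupOf] at hb ⊢
    exact IsGStable.smul_mem g hb

instance IsGStable.quotientAction (S : Subgroup B) [IsGStable G S] :
    MulAction.QuotientAction G S where
  inv_mul_mem g a a' h := by
    have := IsGStable.smul_mem g h
    simpa [smul_mul', smul_inv'] using this

/-- The action of `G` on the quotient by a `G`-stable normal subgroup. -/
instance IsGStable.quotientMulDistribMulAction (S : Subgroup B) [S.Normal] [IsGStable G S] :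
    MulDistribMulAction G (B ⧸ S) where
  smul_mul g x y := by
    induction x using QuotientGroup.induction_on with | H a => ?_
    induction y using QuotientGroup.induction_on with | H b => ?_
    exact congrArg (QuotientGroup.mk (s := S)) (smul_mul' g a b)
  smul_one g := congrArg (QuotientGroup.mk (s := S)) (smul_one g)

theorem IsGStable.smul_mk (S : Subgroup B) [S.Normal] [IsGStable G S] (g : G) (a : B) :
    g • (QuotientGroup.mk a : B ⧸ S) = QuotientGroup.mk (g • a) := rfl

end GGroups

/-! ### The first cohomology group of a topological group with discrete abelian coefficients -/

section Cohomology

variable (G M : Type*) [Group G] [TopologicalSpace G] [CommGroup M] [MulDistribMulAction G M]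

/-- Continuous 1-cocycles, `M` being discrete. -/
def contOneCocycles : Subgroup (G → M) where
  carrier := {f | IsLocallyConstant f ∧ ∀ σ τ, f (σ * τ) = f σ * σ • f τ}
  one_mem' := ⟨IsLocallyConstant.const 1, fun σ τ => by simp⟩
  mul_mem' := by
    rintro f f' ⟨h1, h2⟩ ⟨h1', h2'⟩
    refine ⟨h1.mul h1', fun σ τ => ?_⟩
    simp only [Pi.mul_apply, h2, h2', smul_mul']
    exact mul_mul_mul_comm _ _ _ _
  inv_mem' := by
    rintro f ⟨h1, h2⟩
    refine ⟨h1.inv, fun σ τ => ?_⟩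
    simp only [Pi.inv_apply, h2, smul_inv', mul_inv]

/-- The 1-coboundaries `σ ↦ m⁻¹ · σ(m)`, as a subgroup of the continuous 1-cocycles. -/
def contOneCoboundaries : Subgroup (contOneCocycles G M) where
  carrier := {f | ∃ m : M, ∀ σ : G, f.1 σ = m⁻¹ * σ • m}
  one_mem' := ⟨1, fun σ => by simp⟩
  mul_mem' := by
    rintro f f' ⟨m, h⟩ ⟨m', h'⟩
    refine ⟨m * m', fun σ => ?_⟩
    simp only [Subgroup.coe_mul, Pi.mul_apply, h, h', smul_mul', mul_inv]
    exact mul_mul_mul_comm _ _ _ _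
  inv_mem' := by
    rintro f ⟨m, h⟩
    refine ⟨m⁻¹, fun σ => ?_⟩
    simp only [Subgroup.coe_inv, Pi.inv_apply, h, smul_inv', mul_inv]

/-- `H¹(G, M)`. -/
abbrev contH1 : Type _ := contOneCocycles G M ⧸ contOneCoboundaries G M

end Cohomology

/-! ### Galois action on `GL₂`, and the connecting map -/

section Galois

open Matrix

variable (k : Type*) {Ω : Type*} [Field k] [Field Ω] [Algebra k Ω]

/-- The Galois group acts on `GL₂(Ω)` through the matrix entries. -/
instance galoisActionGL : MulDistribMulAction Gal(Ω/k) (GL (Fin 2) Ω) where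
  smul σ M := GeneralLinearGroup.map (σ : Ω →+* Ω) M
  one_smul M := by ext i j; rfl
  mul_smul σ τ M := by ext i j; rfl
  smul_mul σ M N := map_mul (GeneralLinearGroup.map (σ : Ω →+* Ω)) M N
  smul_one σ := map_one (GeneralLinearGroup.map (σ : Ω →+* Ω))

theorem galoisActionGL_apply (σ : Gal(Ω/k)) (M : GL (Fin 2) Ω) (i j : Fin 2) :
    (σ • M : GL (Fin 2) Ω) i j = σ (M i j) := rfl

variable (Ω) in
/-- The subgroup `{±1}` of `GL₂(Ω)`. -/
def plusMinusOne : Subgroup (GL (Fin 2) Ω) := Subgroup.zpowers (-1)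

theorem mem_plusMinusOne {M : GL (Fin 2) Ω} : M ∈ plusMinusOne Ω ↔ M = 1 ∨ M = -1 := by
  constructor
  · rintro ⟨n, rfl⟩
    rcases Int.even_or_odd n with h | h
    · left; simp [h.neg_one_zpow]
    · right; simp [h.neg_one_zpow]
  · rintro (rfl | rfl)
    · exact one_mem _
    · exact Subgroup.mem_zpowers _

instance plusMinusOne.commGroup : CommGroup (plusMinusOne Ω) :=
  { (inferInstance : Group (plusMinusOne Ω)) with
    mul_comm := fun a b => by
      obtain ⟨a, ha⟩ := a
      obtain ⟨b, hb⟩ := b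
      apply Subtype.ext
      change a * b = b * a
      rcases mem_plusMinusOne.1 ha with rfl | rfl <;> simp }

instance plusMinusOne.isGStable : IsGStable Gal(Ω/k) (plusMinusOne Ω) where
  smul_mem σ b hb := by
    rw [mem_plusMinusOne] at hb ⊢
    rcases hb with rfl | rfl
    · left; exact smul_one σ
    · right
      ext i j
      rw [galoisActionGL_apply]
      simp [Matrix.one_apply, apply_ite σ]

theorem plusMinusOne.mul_comm' {c : GL (Fin 2) Ω} (hc : c ∈ plusMinusOne Ω)
    (b : GL (Fin 2) Ω) : c * b = b * c := by
  rcases mem_plusMinusOne.1 hc with rfl | rfl <;> simp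

instance plusMinusOne.normal : (plusMinusOne Ω).Normal where
  conj_mem c hc b := by
    rw [← plusMinusOne.mul_comm' hc b, mul_inv_cancel_right]
    exact hc

theorem plusMinusOne.smul_eq (σ : Gal(Ω/k)) (c : plusMinusOne Ω) : σ • c = c := by
  apply Subtype.ext
  rw [IsGStable.coe_smul]
  rcases mem_plusMinusOne.1 c.2 with h | h <;> rw [h]
  · exact smul_one σ
  · ext i j
    rw [galoisActionGL_apply]
    simp [Matrix.one_apply, apply_ite σ]

/-- The field of definition of an action of the Galois group on a set `X`:
the fixed field of the kernel of the action. -/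
def fieldOfDefinition (k Ω X : Type*) [Field k] [Field Ω] [Algebra k Ω]
    [MulAction Gal(Ω/k) X] : IntermediateField k Ω :=
  IntermediateField.fixedField (MulAction.toPermHom Gal(Ω/k) X).ker

/-- The field generated over `k` by the square roots in `Ω` of the elements of `S`. -/
def adjoinSqrt (k Ω : Type*) [Field k] [Field Ω] [Algebra k Ω] (S : Set kˣ) :
    IntermediateField k Ω :=
  IntermediateField.adjoin k {x | ∃ a ∈ S, x ^ 2 = algebraMap k Ω a}

variable {k}

/-- The subgroup of `kˣ` generated by the squares and by `S`. -/
def squaresAnd (S : Set kˣ) : Subgroup kˣ :=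
  (powMonoidHom 2 : kˣ →* kˣ).range ⊔ Subgroup.closure S

/-- The reduced group `A' = A/{±1}`. -/
abbrev ReducedGroup (A : Subgroup (GL (Fin 2) Ω)) : Type _ := A ⧸ (plusMinusOne Ω).subgroupOf A

theorem inv_mul_smul_mem (A : Subgroup (GL (Fin 2) Ω)) [IsGStable Gal(Ω/k) A] (a : A)
    (h : (QuotientGroup.mk a : ReducedGroup A) ∈
      FixedPoints.subgroup Gal(Ω/k) (ReducedGroup A)) (σ : Gal(Ω/k)) :
    (a : GL (Fin 2) Ω)⁻¹ * σ • (a : GL (Fin 2) Ω) ∈ plusMinusOne Ω := by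
  have h1 : (QuotientGroup.mk a : ReducedGroup A) = QuotientGroup.mk (σ • a) :=
    ((FixedPoints.mem_subgroup _ _ _).1 h σ).symm
  have h2 := QuotientGroup.eq.1 h1
  rwa [Subgroup.mem_subgroupOf] at h2

theorem sq_root_smul {a : kˣ} {x : Ω} (hx : x ^ 2 = algebraMap k Ω a) (σ : Gal(Ω/k)) :
    σ x = x ∨ σ x = -x := by
  apply sq_eq_sq_iff_eq_or_eq_neg.1
  rw [← map_pow, hx, AlgEquiv.commutes]

variable [Algebra.IsAlgebraic k Ω]

/-- Matrices over an algebraic extension have open stabilizers. -/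
theorem isLocallyConstant_smulGL (M : GL (Fin 2) Ω) :
    IsLocallyConstant fun σ : Gal(Ω/k) => σ • M := by
  rw [IsLocallyConstant.iff_eventually_eq]
  intro σ
  have h : ∀ i j, ∀ᶠ τ : Gal(Ω/k) in nhds σ, τ (M i j) = σ (M i j) := by
    intro i j
    have ho : IsOpen {ρ : Gal(Ω/k) | ρ (M i j) = M i j} :=
      stabilizer_isOpen_of_isIntegral (K := k) (M i j)
    have h2 : IsOpen {τ : Gal(Ω/k) | σ⁻¹ * τ ∈ {ρ : Gal(Ω/k) | ρ (M i j) = M i j}} :=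
      ho.preimage (continuous_const.mul continuous_id)
    filter_upwards [h2.mem_nhds (by simp)] with τ hτ
    have := congrArg σ hτ
    rwa [← AlgEquiv.mul_apply, mul_inv_cancel_left] at this
  filter_upwards [h 0 0, h 0 1, h 1 0, h 1 1] with τ h1 h2 h3 h4
  ext i j
  rw [galoisActionGL_apply, galoisActionGL_apply]
  fin_cases i <;> fin_cases j <;> assumption

section Connecting

variable (A : Subgroup (GL (Fin 2) Ω)) [IsGStable Gal(Ω/k) A]

/-- The 1-cocycle `σ ↦ a⁻¹ · σ(a)` with values in `{±1}` attached to an element `a` of `A`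
whose class in `A/{±1}` is fixed by the Galois group. -/
def connectingCocycle (a : A)
    (h : (QuotientGroup.mk a : ReducedGroup A) ∈
      FixedPoints.subgroup Gal(Ω/k) (ReducedGroup A)) :
    contOneCocycles Gal(Ω/k) (plusMinusOne Ω) :=
  ⟨fun σ => ⟨(a : GL (Fin 2) Ω)⁻¹ * σ • (a : GL (Fin 2) Ω), inv_mul_smul_mem A a h σ⟩, by
    constructor
    · have h1 : IsLocallyConstant fun σ : Gal(Ω/k) =>
          (a : GL (Fin 2) Ω)⁻¹ * σ • (a : GL (Fin 2) Ω) :=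
        (isLocallyConstant_smulGL (a : GL (Fin 2) Ω)).comp fun M => (a : GL (Fin 2) Ω)⁻¹ * M
      exact IsLocallyConstant.desc _ Subtype.val h1 Subtype.val_injective
    · intro σ τ
      apply Subtype.ext
      simp [IsGStable.coe_smul, smul_mul', smul_inv', mul_smul, mul_assoc]⟩

/-- The class of the cocycle depends only on the class of `a`. -/
theorem connectingCocycle_eq (a b : A)
    (ha : (QuotientGroup.mk a : ReducedGroup A) ∈
      FixedPoints.subgroup Gal(Ω/k) (ReducedGroup A))
    (hb : (QuotientGroup.mk b : ReducedGroup A) ∈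
      FixedPoints.subgroup Gal(Ω/k) (ReducedGroup A))
    (hab : (QuotientGroup.mk a : ReducedGroup A) = QuotientGroup.mk b) :
    (QuotientGroup.mk (connectingCocycle A a ha) : contH1 Gal(Ω/k) (plusMinusOne Ω)) =
      QuotientGroup.mk (connectingCocycle A b hb) := by
  have h := QuotientGroup.eq.1 hab
  rw [Subgroup.mem_subgroupOf] at h
  refine QuotientGroup.eq.2 ⟨⟨_, h⟩, fun σ => ?_⟩
  have hc : σ • (⟨_, h⟩ : plusMinusOne Ω) = ⟨_, h⟩ := plusMinusOne.smul_eq k σ ⟨_, h⟩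
  rw [hc, inv_mul_cancel]
  have hc' := congrArg (Subtype.val) hc
  rw [IsGStable.coe_smul] at hc'
  simp only [Subgroup.coe_mul, Subgroup.coe_inv, smul_mul', smul_inv'] at hc'
  apply Subtype.ext
  have hm := inv_mul_smul_mem A a ha σ
  have hcm := plusMinusOne.mul_comm' h
  simp only [Subgroup.coe_mul, Subgroup.coe_inv] at hcm
  change ((a : GL (Fin 2) Ω)⁻¹ * σ • (a : GL (Fin 2) Ω))⁻¹ *
    ((b : GL (Fin 2) Ω)⁻¹ * σ • (b : GL (Fin 2) Ω)) = 1
  have e : σ • (b : GL (Fin 2) Ω) =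
      σ • (a : GL (Fin 2) Ω) * ((a : GL (Fin 2) Ω)⁻¹ * (b : GL (Fin 2) Ω)) := by
    rw [← hc', mul_inv_cancel_left]
  have e' : (b : GL (Fin 2) Ω)⁻¹ * σ • (b : GL (Fin 2) Ω) =
      (a : GL (Fin 2) Ω)⁻¹ * σ • (a : GL (Fin 2) Ω) := by
    rw [e, ← hcm, ← mul_assoc, ← hcm, mul_inv_cancel_right]
  rw [e', inv_mul_cancel]

/-- The connecting homomorphism `δ : A'^G → H¹(G, {±1})` of the exact sequence
`1 → {±1} → A → A' → 1`: the class of `a` goes to the class of `σ ↦ a⁻¹ · σ(a)`. -/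
noncomputable def connectingHom :
    FixedPoints.subgroup Gal(Ω/k) (ReducedGroup A) →* contH1 Gal(Ω/k) (plusMinusOne Ω) :=
  MonoidHom.mk'
    (fun x => QuotientGroup.mk (connectingCocycle A (Quotient.out x.1) (by
      rw [QuotientGroup.out_eq']; exact x.2)))
    (by
      rintro ⟨x, hx⟩ ⟨y, hy⟩
      induction x using QuotientGroup.induction_on with | H a => ?_
      induction y using QuotientGroup.induction_on with | H b => ?_
      have hxy := mul_mem hx hy
      rw [connectingCocycle_eq A _ a _ hx (QuotientGroup.out_eq' _),
        connectingCocycle_eq A _ b _ hy (QuotientGroup.out_eq' _),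
        ← QuotientGroup.mk_mul]
      refine (connectingCocycle_eq A _ (a * b) _ hxy (QuotientGroup.out_eq' _)).trans ?_
      congr 1
      ext1
      funext σ
      apply Subtype.ext
      have hc := plusMinusOne.mul_comm' (inv_mul_smul_mem A a hx σ) (b : GL (Fin 2) Ω)⁻¹
      change ((a : GL (Fin 2) Ω) * b)⁻¹ * σ • ((a : GL (Fin 2) Ω) * b) =
        ((a : GL (Fin 2) Ω)⁻¹ * σ • (a : GL (Fin 2) Ω)) *
          ((b : GL (Fin 2) Ω)⁻¹ * σ • (b : GL (Fin 2) Ω))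
      rw [← mul_assoc, hc, smul_mul', _root_.mul_inv_rev]
      simp only [mul_assoc])

/-- The group `H¹(G, {±1}) / δ(A'^G)` of hyperelliptic twists. -/
abbrev HyperellipticTwists (k : Type*) {Ω : Type*} [Field k] [Field Ω] [Algebra k Ω]
    [Algebra.IsAlgebraic k Ω] (A : Subgroup (GL (Fin 2) Ω)) [IsGStable Gal(Ω/k) A] : Type _ :=
  contH1 Gal(Ω/k) (plusMinusOne Ω) ⧸ (connectingHom (k := k) A).range

end Connecting

section Kummer

open Classical in
/-- The 1-cocycle `σ ↦ σ(x)/x` with values in `{±1}` attached to a square root `x` of `a`. -/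
noncomputable def kummerCocycle {a : kˣ} {x : Ω} (hx : x ^ 2 = algebraMap k Ω a) :
    contOneCocycles Gal(Ω/k) (plusMinusOne Ω) :=
  ⟨fun σ => if σ x = x then 1 else ⟨-1, mem_plusMinusOne.2 (Or.inr rfl)⟩, by
    constructor
    · have h1 : IsLocallyConstant fun σ : Gal(Ω/k) => σ x := by
        rw [IsLocallyConstant.iff_eventually_eq]
        intro σ
        have ho : IsOpen {ρ : Gal(Ω/k) | ρ x = x} :=
          stabilizer_isOpen_of_isIntegral (K := k) x
        have h2 : IsOpen {τ : Gal(Ω/k) | σ⁻¹ * τ ∈ {ρ : Gal(Ω/k) | ρ x = x}} :=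
          ho.preimage (continuous_const.mul continuous_id)
        filter_upwards [h2.mem_nhds (by simp)] with τ hτ
        have := congrArg σ hτ
        rwa [← AlgEquiv.mul_apply, mul_inv_cancel_left] at this
      exact h1.comp fun y => if y = x then (1 : plusMinusOne Ω) else
        ⟨-1, mem_plusMinusOne.2 (Or.inr rfl)⟩
    · intro σ τ
      rw [plusMinusOne.smul_eq]
      have hs := sq_root_smul hx σ
      have ht := sq_root_smul hx τ
      simp only [AlgEquiv.mul_apply]
      by_cases h1 : σ x = x <;> by_cases h2 : τ x = x
      · simp [h1, h2]
      · have h2' := ht.resolve_left h2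
        have h3 : -x ≠ x := h2' ▸ h2
        simp [h2', h1, h3]
      · simp [h1, h2]
      · have h2' := ht.resolve_left h2
        have h1' := hs.resolve_left h1
        have h3 : -x ≠ x := h2' ▸ h2
        simp [h2', h1', h3]
        apply Subtype.ext
        simp⟩

/-- The Kummer class of `a ∈ kˣ` in `H¹(G, {±1})`. -/
noncomputable def kummerClass (k Ω : Type*) [Field k] [Field Ω] [Algebra k Ω]
    [IsAlgClosure k Ω] (a : kˣ) :
    contH1 Gal(Ω/k) (plusMinusOne Ω) :=
  QuotientGroup.mk (kummerCocycle (Classical.choose_spec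
    ((IsAlgClosure.isAlgClosed k (K := Ω)).exists_pow_nat_eq
      (algebraMap k Ω a) zero_lt_two)))

end Kummer

end Galois

section Dihedral

variable {n : ℕ} {A : Type*} [Group A]

/-- The subgroup `⟨V ^ d⟩` of a group `A` identified with the dihedral group
`⟨U, V | U² = Vⁿ = 1, V U = U V⁻¹⟩` of order `2n`. -/
def rotationSubgroup (φ : DihedralGroup n ≃* A) (d : ℕ) : Subgroup A :=
  Subgroup.zpowers (φ (DihedralGroup.r 1) ^ d)

theorem rotationSubgroup_characteristic (hn : 2 < n) (φ : DihedralGroup n ≃* A) (d : ℕ) :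
    (rotationSubgroup φ d).Characteristic := by
  rw [Subgroup.characteristic_iff_map_le]
  intro ψ
  rw [rotationSubgroup, MonoidHom.map_zpowers, Subgroup.zpowers_le]
  have key : ∃ j : ℤ, ψ (φ (DihedralGroup.r 1)) = φ (DihedralGroup.r 1) ^ j := by
    obtain ⟨g, hg⟩ := φ.surjective (ψ (φ (DihedralGroup.r 1)))
    rcases g with i | i
    · obtain ⟨m, rfl⟩ := ZMod.intCast_surjective i
      exact ⟨m, by rw [← hg, ← map_zpow]; simp [DihedralGroup.r_zpow]⟩
    · exfalso
      have h2 : ψ (φ (DihedralGroup.r 1)) ^ 2 = 1 := by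
        rw [← hg, ← map_pow, pow_two, DihedralGroup.sr_mul_self, map_one]
      rw [← map_pow, ← map_pow, EmbeddingLike.map_eq_one_iff, EmbeddingLike.map_eq_one_iff,
        ← orderOf_dvd_iff_pow_eq_one, DihedralGroup.orderOf_r_one] at h2
      exact absurd (Nat.le_of_dvd two_pos h2) (by omega)
  obtain ⟨j, hj⟩ := key
  change ψ (φ (DihedralGroup.r 1) ^ d) ∈ _
  rw [map_pow, hj, ← zpow_natCast (_ ^ j), ← zpow_mul, mul_comm, zpow_mul, zpow_natCast]
  exact Subgroup.zpow_mem _ (Subgroup.mem_zpowers _) j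

instance (φ : DihedralGroup 4 ≃* A) (d : ℕ) : (rotationSubgroup φ d).Characteristic :=
  rotationSubgroup_characteristic (by norm_num) φ d

instance (φ : DihedralGroup 6 ≃* A) (d : ℕ) : (rotationSubgroup φ d).Characteristic :=
  rotationSubgroup_characteristic (by norm_num) φ d

end Dihedral

/-!
The Galois group `G` acts trivially on `{±1}`, so `H¹(G, {±1})` is the group of continuous sign
characters of `G` (`signCharacter`), and Kummer theory identifies it with `kˣ / kˣ²`: the square
roots of an element `a` are fixed exactly by the kernel of `κ(a)`, and an open subgroup of index
two with nontrivial coset `σ₀` is the stabilizer of `x - σ₀ x` for a suitable `x`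
(`exists_kummerClass_eq_one_iff_mem`). Hence the group of twists is `kˣ / ⟨kˣ², S⟩` as soon as the
image of `δ` is generated by the classes of the elements of `S`
(`exists_mulEquiv_hyperellipticTwists`).

Infinite Galois theory turns an equality between a field of definition and a field generated by
square roots into an equality between the kernel of the action and an intersection of kernels of
sign characters. A sign character that is trivial on the intersection of the kernels of two others
lies in the group generated by them (`mem_closure_pair_of_ker_inf_le`), so two such groups are
compared by comparing kernels.

A central involution of a nonabelian group of `2 × 2` matrices is `-1`, so `-1` is the rotation of
order two of the dihedral group, and `δ` sends an element `a` with `σ a = ± a` for all `σ` to the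
character that is trivial on the stabilizer of `a`. Every automorphism of a dihedral group
of order greater than four has the form
`V ^ i ↦ V ^ (u i)`, `U V ^ i ↦ U V ^ (c + u i)`, which reduces the remaining questions to
arithmetic modulo four and six.

* For the group of order eight, `V` is always fixed modulo `±1` and gives `κ(v)`. If the reduced
  group has trivial action, then `U` gives a second character, and the two together cut out the
  field of definition of `A`. Otherwise no reflection is fixed modulo `±1`.
* For the group of order twelve, rotations fixed modulo `±1` are fixed, since they have odd order
  modulo `±1`. If three divides `[K : k]`, then some Galois automorphism permutes the
  reflections modulo `±1` cyclically, so `δ` is trivial. Otherwise some reflection is fixed modulo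
  `±1`, and its character is the one by which `G` acts on `A / ⟨V²⟩`, because `-1` is not in
  `⟨V²⟩`.
-/

/-! ### Homomorphisms to a group with two elements -/

section SignCharacters

variable {H C : Type*} [Group H] [CommGroup C] {c : C}

theorem eq_one_or_eq_of_ker_le (hc : ∀ x : C, x = 1 ∨ x = c) {x z : H →* C}
    (h : x.ker ≤ z.ker) : z = 1 ∨ z = x := by
  by_cases hz : ∀ σ, z σ = 1
  · exact Or.inl (MonoidHom.ext hz)
  · right
    push Not at hz
    obtain ⟨σ₀, h₀⟩ := hz
    have h₀' : x σ₀ ≠ 1 := fun e => h₀ (h e)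
    have hx₀ := (hc (x σ₀)).resolve_left h₀'
    have hz₀ := (hc (z σ₀)).resolve_left h₀
    ext σ
    rcases hc (x σ) with e | e
    · rw [e, MonoidHom.mem_ker.1 (h e)]
    · have h1 : σ * σ₀⁻¹ ∈ x.ker := by
        rw [MonoidHom.mem_ker, map_mul, map_inv, e, hx₀, mul_inv_cancel]
      have h2 := MonoidHom.mem_ker.1 (h h1)
      rw [map_mul, map_inv, mul_inv_eq_one, hz₀] at h2
      rw [h2, e]

/-- The subgroup generated by two sign characters contains every sign character that is trivial
where both of them are. -/
theorem mem_closure_pair_of_ker_inf_le (hc : ∀ x : C, x = 1 ∨ x = c) {x y z : H →* C}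
    (h : x.ker ⊓ y.ker ≤ z.ker) : z ∈ Subgroup.closure {x, y} := by
  have hx : x ∈ Subgroup.closure {x, y} := Subgroup.subset_closure (by simp)
  have hy : y ∈ Subgroup.closure {x, y} := Subgroup.subset_closure (by simp)
  -- On `x.ker` the character `z` agrees with `1` or with `y`, so one of `z` and `z / y`
  -- is trivial on `x.ker`.
  have key : (y.comp x.ker.subtype).ker ≤ (z.comp x.ker.subtype).ker :=
    fun σ hσ => h ⟨σ.2, hσ⟩
  rcases eq_one_or_eq_of_ker_le hc key with e | e
  · have h1 : x.ker ≤ z.ker := fun σ hσ => show z σ = 1 from DFunLike.congr_fun e ⟨σ, hσ⟩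
    rcases eq_one_or_eq_of_ker_le hc h1 with e | e
    · rw [e]; exact one_mem _
    · rwa [e]
  · have h1 : x.ker ≤ (z / y).ker := fun σ hσ => by
      rw [MonoidHom.mem_ker, MonoidHom.div_apply, div_eq_one]
      exact DFunLike.congr_fun e ⟨σ, hσ⟩
    rw [← div_mul_cancel z y]
    rcases eq_one_or_eq_of_ker_le hc h1 with e | e
    · rw [e]; exact mul_mem (one_mem _) hy
    · rw [e]; exact mul_mem hx hy

end SignCharacters

/-! ### Cohomology classes with values in `{±1}` as characters -/


section Characters

open Matrix

variable {k Ω : Type*} [Field k] [Field Ω] [Algebra k Ω]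

theorem plusMinusOne.eq_one_or (x : plusMinusOne Ω) :
    x = 1 ∨ x = ⟨-1, mem_plusMinusOne.2 (Or.inr rfl)⟩ :=
  (mem_plusMinusOne.1 x.2).imp Subtype.ext Subtype.ext

theorem neg_one_ne_one_of_ringChar_ne_two (h2 : ringChar k ≠ 2) : (-1 : Ω) ≠ 1 := by
  intro h
  apply Ring.neg_one_ne_one_of_char_ne_two h2
  apply (algebraMap k Ω).injective
  simpa using h

theorem neg_one_ne_one_GL (h2 : ringChar k ≠ 2) : (-1 : GL (Fin 2) Ω) ≠ 1 := by
  intro h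
  apply neg_one_ne_one_of_ringChar_ne_two (k := k) (Ω := Ω) h2
  simpa using congrArg (fun M : GL (Fin 2) Ω => M 0 0) h

/-- The character attached to a class in `H¹(G, {±1})`. The action of `G` on `{±1}` is trivial,
so continuous cocycles are homomorphisms and coboundaries vanish. -/
def signCharacter :
    contH1 Gal(Ω/k) (plusMinusOne Ω) →* (Gal(Ω/k) →* plusMinusOne Ω) :=
  QuotientGroup.lift _
    { toFun := fun f => MonoidHom.mk' f.1 fun σ τ => by
        rw [f.2.2, plusMinusOne.smul_eq]
      map_one' := rfl
      map_mul' := fun _ _ => rfl }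
    (by
      rintro f ⟨m, hm⟩
      ext1 σ
      change f.1 σ = 1
      rw [hm, plusMinusOne.smul_eq, inv_mul_cancel])

theorem signCharacter_mk (f : contOneCocycles Gal(Ω/k) (plusMinusOne Ω)) (σ : Gal(Ω/k)) :
    signCharacter (QuotientGroup.mk f) σ = f.1 σ := rfl

theorem signCharacter_injective :
    Function.Injective (signCharacter (k := k) (Ω := Ω)) := by
  rw [injective_iff_map_eq_one]
  intro x hx
  induction x using QuotientGroup.induction_on with | H f => ?_
  refine (QuotientGroup.eq_one_iff f).2 ⟨1, fun σ => ?_⟩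
  rw [← signCharacter_mk, hx]
  simp

theorem mem_closure_pair_of_signCharacter {x y z : contH1 Gal(Ω/k) (plusMinusOne Ω)}
    (h : ∀ σ, signCharacter x σ = 1 → signCharacter y σ = 1 → signCharacter z σ = 1) :
    z ∈ Subgroup.closure {x, y} := by
  rw [← Subgroup.mem_map_iff_mem signCharacter_injective, MonoidHom.map_closure,
    Set.image_pair]
  exact mem_closure_pair_of_ker_inf_le plusMinusOne.eq_one_or fun σ hσ => h σ hσ.1 hσ.2

theorem mem_closure_singleton_of_signCharacter {x z : contH1 Gal(Ω/k) (plusMinusOne Ω)}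
    (h : ∀ σ, signCharacter x σ = 1 → signCharacter z σ = 1) :
    z ∈ Subgroup.closure {x} := by
  simpa using mem_closure_pair_of_signCharacter (x := x) (y := x) fun σ hσ _ => h σ hσ

end Characters

/-! ### Kummer theory for square roots -/

section KummerTheory

open Matrix

variable {k Ω : Type*} [Field k] [Field Ω] [Algebra k Ω]

theorem kummerCocycle_apply_eq_one_iff [Algebra.IsAlgebraic k Ω] (h2 : ringChar k ≠ 2) {a : kˣ}
    {x : Ω} (hx : x ^ 2 = algebraMap k Ω a) (σ : Gal(Ω/k)) :
    (kummerCocycle hx).1 σ = 1 ↔ σ x = x := by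
  unfold kummerCocycle
  dsimp only
  split_ifs with h
  · simp [h]
  · exact ⟨fun e => absurd (congrArg Subtype.val e) (neg_one_ne_one_GL (k := k) h2),
      fun e => absurd e h⟩

theorem signCharacter_kummerClass [IsAlgClosure k Ω] (h2 : ringChar k ≠ 2) {a : kˣ} {x : Ω}
    (hx : x ^ 2 = algebraMap k Ω a) (σ : Gal(Ω/k)) :
    signCharacter (kummerClass k Ω a) σ = 1 ↔ σ x = x := by
  have hy := Classical.choose_spec ((IsAlgClosure.isAlgClosed k (K := Ω)).exists_pow_nat_eq
    (algebraMap k Ω a) zero_lt_two)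
  rw [kummerClass, signCharacter_mk, kummerCocycle_apply_eq_one_iff h2]
  rcases sq_eq_sq_iff_eq_or_eq_neg.1 (hx.trans hy.symm) with e | e <;> rw [e]
  rw [map_neg, neg_inj]

theorem exists_sq_eq_algebraMap [IsAlgClosure k Ω] (a : k) :
    ∃ x : Ω, x ^ 2 = algebraMap k Ω a :=
  (IsAlgClosure.isAlgClosed k (K := Ω)).exists_pow_nat_eq _ zero_lt_two

variable (k Ω) in
/-- The Kummer map `kˣ → H¹(G, {±1})`. -/
noncomputable def kummerHom [IsAlgClosure k Ω] (h2 : ringChar k ≠ 2) :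
    kˣ →* contH1 Gal(Ω/k) (plusMinusOne Ω) :=
  MonoidHom.mk' (kummerClass k Ω) fun a b => by
    apply signCharacter_injective
    ext1 σ
    obtain ⟨x, hx⟩ := exists_sq_eq_algebraMap (Ω := Ω) (a : k)
    obtain ⟨y, hy⟩ := exists_sq_eq_algebraMap (Ω := Ω) (b : k)
    have hxy : (x * y) ^ 2 = algebraMap k Ω ((a * b : kˣ) : k) := by
      rw [mul_pow, hx, hy, Units.val_mul, map_mul]
    have ha := signCharacter_kummerClass h2 hx σ
    have hb := signCharacter_kummerClass h2 hy σ
    have hab := signCharacter_kummerClass h2 hxy σ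
    have hx0 : x ≠ 0 := by
      rintro rfl
      exact a.ne_zero ((algebraMap k Ω).injective (by simpa using hx.symm))
    have hy0 : y ≠ 0 := by
      rintro rfl
      exact b.ne_zero ((algebraMap k Ω).injective (by simpa using hy.symm))
    have hneg : ∀ z : Ω, z ≠ 0 → -z ≠ z := fun z hz h =>
      neg_one_ne_one_of_ringChar_ne_two (k := k) (Ω := Ω) h2
        (mul_right_cancel₀ hz (by simpa using h))
    have hmul : (⟨-1, mem_plusMinusOne.2 (Or.inr rfl)⟩ : plusMinusOne Ω) *
        ⟨-1, mem_plusMinusOne.2 (Or.inr rfl)⟩ = 1 := Subtype.ext (by simp)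
    rw [map_mul] at hab
    rw [map_mul, MonoidHom.mul_apply]
    rcases sq_root_smul hx σ with e | e <;> rcases sq_root_smul hy σ with f | f
    · rw [ha.2 e, hb.2 f, hab.2 (by rw [e, f]), mul_one]
    · have h3 := mt hb.1 (by rw [f]; exact hneg y hy0)
      have h4 := mt hab.1 (by rw [e, f, mul_neg]; exact hneg _ (mul_ne_zero hx0 hy0))
      rw [ha.2 e, one_mul, (plusMinusOne.eq_one_or _).resolve_left h3,
        (plusMinusOne.eq_one_or _).resolve_left h4]
    · have h3 := mt ha.1 (by rw [e]; exact hneg x hx0)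
      have h4 := mt hab.1 (by rw [e, f, neg_mul]; exact hneg _ (mul_ne_zero hx0 hy0))
      rw [hb.2 f, mul_one, (plusMinusOne.eq_one_or _).resolve_left h3,
        (plusMinusOne.eq_one_or _).resolve_left h4]
    · have h3 := mt ha.1 (by rw [e]; exact hneg x hx0)
      have h4 := mt hb.1 (by rw [f]; exact hneg y hy0)
      rw [hab.2 (by rw [e, f, neg_mul_neg]), (plusMinusOne.eq_one_or _).resolve_left h3,
        (plusMinusOne.eq_one_or _).resolve_left h4, hmul]

theorem kummerHom_apply [IsAlgClosure k Ω] (h2 : ringChar k ≠ 2) (a : kˣ) :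
    kummerHom k Ω h2 a = kummerClass k Ω a := rfl

theorem ker_kummerHom [PerfectField k] [IsAlgClosure k Ω] (h2 : ringChar k ≠ 2) :
    (kummerHom k Ω h2).ker = (powMonoidHom 2 : kˣ →* kˣ).range := by
  ext a
  obtain ⟨x, hx⟩ := exists_sq_eq_algebraMap (Ω := Ω) (a : k)
  have h1 : a ∈ (kummerHom k Ω h2).ker ↔ ∀ σ : Gal(Ω/k), σ x = x := by
    rw [MonoidHom.mem_ker, ← map_eq_one_iff _ signCharacter_injective, DFunLike.ext_iff]
    exact forall_congr' fun σ => signCharacter_kummerClass h2 hx σ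
  have : IsGalois k Ω := { }
  rw [h1, ← InfiniteGalois.mem_bot_iff_fixed, IntermediateField.mem_bot]
  constructor
  · rintro ⟨b, rfl⟩
    rw [← map_pow] at hx
    have hb : b ^ 2 = a := (algebraMap k Ω).injective hx
    have hb0 : b ≠ 0 := fun h => a.ne_zero (by rw [← hb, h]; simp)
    exact ⟨Units.mk0 b hb0, Units.ext hb⟩
  · rintro ⟨b, rfl⟩
    have hx' : x ^ 2 = (algebraMap k Ω b) ^ 2 := by rw [hx]; simp
    rcases sq_eq_sq_iff_eq_or_eq_neg.1 hx' with e | e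
    · exact ⟨b, e.symm⟩
    · exact ⟨-b, by rw [e, map_neg]⟩

/-- An open subgroup `N` of the Galois group of index at most two is the stabilizer of a square
root of an element of `k`. -/
theorem exists_kummerClass_eq_one_iff_mem [PerfectField k] [IsAlgClosure k Ω]
    (h2 : ringChar k ≠ 2) (N : Subgroup Gal(Ω/k)) (hN : IsOpen (N : Set Gal(Ω/k)))
    (hmul : ∀ σ τ, σ ∉ N → τ ∉ N → σ * τ ∈ N) :
    ∃ a : kˣ, ∀ σ, signCharacter (kummerClass k Ω a) σ = 1 ↔ σ ∈ N := by
  have : IsGalois k Ω := { }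
  by_cases htop : N = ⊤
  · refine ⟨1, fun σ => ?_⟩
    rw [signCharacter_kummerClass h2 (x := 1) (by simp), htop]
    simp
  obtain ⟨σ₀, h₀⟩ : ∃ σ₀, σ₀ ∉ N := by
    by_contra! h
    exact htop (eq_top_iff.2 fun σ _ => h σ)
  have hfix : (IntermediateField.fixedField N).fixingSubgroup = N :=
    InfiniteGalois.fixingSubgroup_fixedField ⟨N, N.isClosed_of_isOpen hN⟩
  obtain ⟨x, hxN, hx⟩ : ∃ x ∈ IntermediateField.fixedField N, σ₀ x ≠ x := by
    by_contra! h
    apply h₀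
    rw [← hfix, IntermediateField.mem_fixingSubgroup_iff]
    exact h
  rw [IntermediateField.mem_fixedField_iff] at hxN
  -- The anti-invariant element `x - σ₀ x` is the required square root.
  set y := x - σ₀ x with hy
  have hy0 : y ≠ 0 := sub_ne_zero.2 hx.symm
  have hpos : ∀ σ ∈ N, σ y = y := by
    intro σ hσ
    have h1 : σ₀⁻¹ * σ * σ₀ ∈ N := by
      apply hmul _ _ _ h₀
      intro h
      have := N.mul_mem h (N.inv_mem hσ)
      rw [mul_inv_cancel_right] at this
      exact h₀ (N.inv_mem_iff.1 this)
    have h3 := congrArg σ₀ (hxN _ h1)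
    rw [← AlgEquiv.mul_apply, mul_assoc, mul_inv_cancel_left, AlgEquiv.mul_apply] at h3
    rw [hy, map_sub, hxN σ hσ, h3]
  have hneg : ∀ σ ∉ N, σ y = -y := by
    intro σ hσ
    have h3 := hxN _ (hmul σ σ₀ hσ h₀)
    have h4 : σ x = σ₀ x := by
      have h5 : σ₀⁻¹ * σ ∈ N := hmul _ _ (fun h => h₀ (N.inv_mem_iff.1 h)) hσ
      have h6 := congrArg σ₀ (hxN _ h5)
      rwa [← AlgEquiv.mul_apply, mul_inv_cancel_left] at h6
    rw [AlgEquiv.mul_apply] at h3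
    rw [hy, map_sub, h3, h4, neg_sub]
  have hbot : y ^ 2 ∈ (⊥ : IntermediateField k Ω) := by
    rw [InfiniteGalois.mem_bot_iff_fixed]
    intro σ
    by_cases hσ : σ ∈ N
    · rw [map_pow, hpos σ hσ]
    · rw [map_pow, hneg σ hσ, neg_sq]
  obtain ⟨a, ha⟩ := IntermediateField.mem_bot.1 hbot
  have ha0 : a ≠ 0 := by
    rintro rfl
    rw [map_zero] at ha
    exact hy0 (pow_eq_zero_iff two_ne_zero |>.1 ha.symm)
  refine ⟨Units.mk0 a ha0, fun σ => ?_⟩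
  rw [signCharacter_kummerClass h2 (x := y) ha.symm]
  refine ⟨fun h => ?_, hpos σ⟩
  by_contra hσ
  rw [hneg σ hσ] at h
  exact neg_one_ne_one_of_ringChar_ne_two (k := k) (Ω := Ω) h2
    (mul_right_cancel₀ hy0 (by simpa using h))

theorem kummerHom_surjective [PerfectField k] [IsAlgClosure k Ω] (h2 : ringChar k ≠ 2) :
    Function.Surjective (kummerHom k Ω h2) := by
  intro x
  have hopen : IsOpen ((signCharacter x).ker : Set Gal(Ω/k)) := by
    induction x using QuotientGroup.induction_on with | H f => ?_
    exact f.2.1.isOpen_fiber 1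
  obtain ⟨a, ha⟩ := exists_kummerClass_eq_one_iff_mem h2 (signCharacter x).ker hopen
    fun σ τ hσ hτ => by
      rw [MonoidHom.mem_ker] at hσ hτ ⊢
      rw [map_mul, (plusMinusOne.eq_one_or _).resolve_left hσ,
        (plusMinusOne.eq_one_or _).resolve_left hτ]
      exact Subtype.ext (by simp)
  refine ⟨a, signCharacter_injective ?_⟩
  ext1 σ
  have h := ha σ
  rw [← kummerHom_apply h2, MonoidHom.mem_ker] at h
  by_cases hσ : signCharacter x σ = 1
  · rw [hσ, h.2 hσ]
  · rw [(plusMinusOne.eq_one_or _).resolve_left hσ,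
      (plusMinusOne.eq_one_or _).resolve_left (mt h.1 hσ)]

theorem exists_quotient_mulEquiv_of_comap_eq {K M : Type*} [Group K] [Group M]
    {f : K →* M} (hf : Function.Surjective f) {N : Subgroup K} [N.Normal] {D : Subgroup M}
    [D.Normal]     (h : N = D.comap f) :
    ∃ e : K ⧸ N ≃* M ⧸ D, ∀ a : K, e (QuotientGroup.mk a) = QuotientGroup.mk (f a) := by
  have hker : N = ((QuotientGroup.mk' D).comp f).ker := by
    rw [← MonoidHom.comap_ker, QuotientGroup.ker_mk', h]
  exact ⟨(QuotientGroup.quotientMulEquivOfEq hker).trans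
    (QuotientGroup.quotientKerEquivOfSurjective _
      ((QuotientGroup.mk'_surjective D).comp hf)), fun a => rfl⟩

theorem comap_kummerHom_closure [PerfectField k] [IsAlgClosure k Ω]
    (h2 : ringChar k ≠ 2) {S : Set kˣ}
    {D : Subgroup (contH1 Gal(Ω/k) (plusMinusOne Ω))}
    (hD : D = Subgroup.closure (kummerClass k Ω '' S)) :
    squaresAnd S = D.comap (kummerHom k Ω h2) := by
  have h1 : D = (Subgroup.closure S).map (kummerHom k Ω h2) := by
    rw [hD, MonoidHom.map_closure]; rfl
  rw [h1, Subgroup.comap_map_eq, ker_kummerHom, sup_comm, squaresAnd]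

/-- If the image of the connecting homomorphism is generated by the Kummer classes of the elements
of `S`, then the Kummer map identifies the group of hyperelliptic twists with `kˣ / ⟨kˣ², S⟩`. -/
theorem exists_mulEquiv_hyperellipticTwists [PerfectField k] [IsAlgClosure k Ω]
    (h2 : ringChar k ≠ 2) (A : Subgroup (GL (Fin 2) Ω)) [IsGStable Gal(Ω/k) A] {S : Set kˣ}
    (hD : (connectingHom (k := k) A).range = Subgroup.closure (kummerClass k Ω '' S)) :
    ∃ e : kˣ ⧸ squaresAnd S ≃* HyperellipticTwists k A,
      ∀ a : kˣ, e (QuotientGroup.mk a) = QuotientGroup.mk (kummerClass k Ω a) :=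
  exists_quotient_mulEquiv_of_comap_eq (kummerHom_surjective h2) (comap_kummerHom_closure h2 hD)

end KummerTheory

/-! ### Fields of definition -/

section FieldOfDefinition

open Matrix

variable {k Ω : Type*} [Field k] [Field Ω] [Algebra k Ω]

theorem mem_fixingSubgroup_adjoinSqrt [IsAlgClosure k Ω] (h2 : ringChar k ≠ 2) (S : Set kˣ)
    (σ : Gal(Ω/k)) :
    σ ∈ (adjoinSqrt k Ω S).fixingSubgroup ↔
      ∀ a ∈ S, signCharacter (kummerClass k Ω a) σ = 1 := by
  constructor
  · intro h a ha
    obtain ⟨x, hx⟩ := exists_sq_eq_algebraMap (Ω := Ω) (a : k)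
    rw [signCharacter_kummerClass h2 hx]
    exact (IntermediateField.mem_fixingSubgroup_iff _ _).1 h x
      (IntermediateField.subset_adjoin _ _ ⟨a, ha, hx⟩)
  · intro h
    have h1 : adjoinSqrt k Ω S ≤
        IntermediateField.fixedField (Subgroup.zpowers σ) := by
      refine IntermediateField.adjoin_le_iff.2 ?_
      rintro x ⟨a, ha, hx⟩
      have h3 : σ x = x := (signCharacter_kummerClass h2 hx σ).1 (h a ha)
      refine (IntermediateField.mem_fixedField_iff _ _).2 fun τ hτ => ?_
      have h4 : Subgroup.zpowers σ ≤ MulAction.stabilizer Gal(Ω/k) x :=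
        (Subgroup.zpowers_le).2 h3
      exact h4 hτ
    exact (IntermediateField.le_iff_le _ _).1 h1 (Subgroup.mem_zpowers σ)

theorem mem_ker_toPermHom_iff {G X : Type*} [Group G] [MulAction G X] (g : G) :
    g ∈ (MulAction.toPermHom G X).ker ↔ ∀ x : X, g • x = x := by
  rw [MonoidHom.mem_ker, Equiv.ext_iff]
  rfl

theorem isOpen_ker_of_forall_smul_eq [Algebra.IsAlgebraic k Ω] (A : Subgroup (GL (Fin 2) Ω))
    [IsGStable Gal(Ω/k) A] [Finite A] {X : Type*} [MulAction Gal(Ω/k) X]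
    (h : ∀ σ : Gal(Ω/k), (∀ a : A, σ • a = a) → ∀ x : X, σ • x = x) :
    IsOpen ((MulAction.toPermHom Gal(Ω/k) X).ker : Set Gal(Ω/k)) := by
  have h1 : IsOpen ((MulAction.toPermHom Gal(Ω/k) A).ker : Set Gal(Ω/k)) := by
    have h3 : ((MulAction.toPermHom Gal(Ω/k) A).ker : Set Gal(Ω/k)) =
        ⋂ a : A, {σ | σ • (a : GL (Fin 2) Ω) = a} := by
      ext σ
      rw [SetLike.mem_coe, mem_ker_toPermHom_iff, Set.mem_iInter]
      exact forall_congr' fun a => Subtype.ext_iff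
    rw [h3]
    exact isOpen_iInter_of_finite fun a =>
      (isLocallyConstant_smulGL (a : GL (Fin 2) Ω)).isOpen_fiber _
  refine Subgroup.isOpen_mono (fun σ hσ => ?_) h1
  rw [mem_ker_toPermHom_iff] at hσ ⊢
  exact h σ hσ

variable [IsAlgClosure k Ω]

theorem fixingSubgroup_fieldOfDefinition [PerfectField k] (X : Type*) [MulAction Gal(Ω/k) X]
    (hX : IsOpen ((MulAction.toPermHom Gal(Ω/k) X).ker : Set Gal(Ω/k))) :
    (fieldOfDefinition k Ω X).fixingSubgroup = (MulAction.toPermHom Gal(Ω/k) X).ker := by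
  have : IsGalois k Ω := { }
  exact InfiniteGalois.fixingSubgroup_fixedField ⟨_, Subgroup.isClosed_of_isOpen _ hX⟩

theorem fieldOfDefinition_eq_adjoinSqrt_iff [PerfectField k] (h2 : ringChar k ≠ 2) {X : Type*}
    [MulAction Gal(Ω/k) X]
    (hX : IsOpen ((MulAction.toPermHom Gal(Ω/k) X).ker : Set Gal(Ω/k))) (S : Set kˣ) :
    fieldOfDefinition k Ω X = adjoinSqrt k Ω S ↔
      ∀ σ : Gal(Ω/k), (∀ x : X, σ • x = x) ↔
        ∀ a ∈ S, signCharacter (kummerClass k Ω a) σ = 1 := by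
  have : IsGalois k Ω := { }
  have h1 : fieldOfDefinition k Ω X = adjoinSqrt k Ω S ↔
      (fieldOfDefinition k Ω X).fixingSubgroup = (adjoinSqrt k Ω S).fixingSubgroup := by
    refine ⟨fun h => by rw [h], fun h => ?_⟩
    rw [← InfiniteGalois.fixedField_fixingSubgroup (fieldOfDefinition k Ω X), h,
      InfiniteGalois.fixedField_fixingSubgroup]
  rw [h1, fixingSubgroup_fieldOfDefinition X hX, SetLike.ext_iff]
  exact forall_congr' fun σ => by
    rw [mem_ker_toPermHom_iff, mem_fixingSubgroup_adjoinSqrt h2]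

theorem fieldOfDefinition_eq_bot_iff [PerfectField k] (h2 : ringChar k ≠ 2) {X : Type*}
    [MulAction Gal(Ω/k) X]
    (hX : IsOpen ((MulAction.toPermHom Gal(Ω/k) X).ker : Set Gal(Ω/k))) :
    fieldOfDefinition k Ω X = ⊥ ↔ ∀ (σ : Gal(Ω/k)) (x : X), σ • x = x := by
  have h := fieldOfDefinition_eq_adjoinSqrt_iff h2 hX ∅
  have h0 : adjoinSqrt k Ω ∅ = ⊥ := by
    simp [adjoinSqrt]
  rw [h0] at h
  simpa using h

theorem finrank_fieldOfDefinition [PerfectField k] (X : Type*) [MulAction Gal(Ω/k) X]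
    (hX : IsOpen ((MulAction.toPermHom Gal(Ω/k) X).ker : Set Gal(Ω/k))) :
    Module.finrank k (fieldOfDefinition k Ω X) =
      Nat.card (MulAction.toPermHom Gal(Ω/k) X).range := by
  have : IsGalois k Ω := { }
  rw [IntermediateField.finrank_eq_fixingSubgroup_index, fixingSubgroup_fieldOfDefinition X hX,
    Subgroup.index_ker]

end FieldOfDefinition

/-! ### Automorphisms of dihedral groups -/

section DihedralAutomorphisms

open DihedralGroup

variable {n : ℕ}

theorem two_ne_zero_zmod_of_two_lt (hn : 2 < n) : (2 : ZMod n) ≠ 0 := by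
  intro h
  have h1 : ((2 : ℕ) : ZMod n) = 0 := by exact_mod_cast h
  rw [ZMod.natCast_eq_zero_iff] at h1
  exact absurd (Nat.le_of_dvd two_pos h1) (by omega)

theorem exists_dihedralAut_r_one (hn : 2 < n) (F : MulAut (DihedralGroup n)) :
    ∃ u : ZMod n, ∀ i, F (r i) = r (u * i) := by
  have h2 := two_ne_zero_zmod_of_two_lt hn
  obtain ⟨u, hu⟩ : ∃ u, F (r 1) = r u := by
    rcases h : F (r 1) with u | u
    · exact ⟨u, rfl⟩
    · exfalso
      have h3 : F (r 1 * r 1) = 1 := by rw [map_mul, h, sr_mul_self]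
      rw [EmbeddingLike.map_eq_one_iff, r_mul_r, one_def, r.injEq, one_add_one_eq_two] at h3
      exact h2 h3
  refine ⟨u, fun i => ?_⟩
  obtain ⟨m, rfl⟩ := ZMod.intCast_surjective i
  rw [← r_one_zpow, map_zpow, hu, r_zpow]

/-- Every automorphism of a dihedral group of order `2n`, `n > 2`, has the form
`r i ↦ r (u * i)`, `sr i ↦ sr (c + u * i)` with `u` a unit modulo `n`. -/
theorem exists_dihedralAut_apply (hn : 2 < n) (F : MulAut (DihedralGroup n)) :
    ∃ (u : (ZMod n)ˣ) (c : ZMod n),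
      (∀ i, F (r i) = r ((u : ZMod n) * i)) ∧ ∀ i, F (sr i) = sr (c + (u : ZMod n) * i) := by
  have h2 := two_ne_zero_zmod_of_two_lt hn
  obtain ⟨u, hu⟩ := exists_dihedralAut_r_one hn F
  obtain ⟨u', hu'⟩ := exists_dihedralAut_r_one hn F⁻¹
  have huu' : u * u' = 1 := by
    have h : F (F⁻¹ (r 1)) = r 1 := MulAut.apply_inv_self _ F (r 1)
    rw [hu', hu] at h
    simpa using h
  obtain ⟨c, hc⟩ : ∃ c, F (sr 0) = sr c := by
    rcases h : F (sr 0) with c | c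
    · -- Rotations commute, but `sr 0` does not commute with `r 1`.
      exfalso
      have h3 : F (sr 0 * r 1) = F (r 1 * sr 0) := by
        rw [map_mul, map_mul, h, hu, r_mul_r, r_mul_r, add_comm]
      have h4 := F.injective h3
      rw [sr_mul_r, r_mul_sr, sr.injEq] at h4
      apply h2
      linear_combination h4
    · exact ⟨c, rfl⟩
  refine ⟨Units.mkOfMulEqOne u u' huu', c, hu, fun i => ?_⟩
  have h : (sr i : DihedralGroup n) = sr 0 * r i := by rw [sr_mul_r, zero_add]
  rw [h, map_mul, hc, hu, sr_mul_r, Units.val_mkOfMulEqOne]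

theorem dihedralAut_eq_one {F : MulAut (DihedralGroup n)} (h1 : F (r 1) = r 1)
    (h0 : F (sr 0) = sr 0) : F = 1 := by
  have hr : ∀ i, F (r i) = r i := fun i => by
    obtain ⟨m, rfl⟩ := ZMod.intCast_surjective i
    rw [← r_one_zpow, map_zpow, h1]
  ext g
  rcases g with i | i
  · exact hr i
  · have h : (sr i : DihedralGroup n) = sr 0 * r i := by rw [sr_mul_r, zero_add]
    rw [h, map_mul, h0, hr]
    rfl

end DihedralAutomorphisms

/-! ### Actions on groups isomorphic to a dihedral group -/

section DihedralAction

open DihedralGroup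

variable {n : ℕ} {G A : Type*} [Group G] [Group A] [MulDistribMulAction G A]
  (φ : DihedralGroup n ≃* A)

/-- The action on a group `A` transported to a dihedral group along an isomorphism. -/
def dihedralAction : G →* MulAut (DihedralGroup n) :=
  (MulAut.congr φ.symm).toMonoidHom.comp (MulDistribMulAction.toMulAut G A)

theorem map_dihedralAction (σ : G) (g : DihedralGroup n) :
    φ (dihedralAction φ σ g) = σ • φ g :=
  φ.apply_symm_apply _

theorem smul_eq_iff_dihedralAction (σ : G) (g : DihedralGroup n) :
    σ • φ g = φ g ↔ dihedralAction φ σ g = g := by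
  rw [← map_dihedralAction, φ.injective.eq_iff]

theorem forall_smul_eq_iff_dihedralAction (σ : G) :
    (∀ a : A, σ • a = a) ↔ dihedralAction φ σ = 1 := by
  rw [φ.surjective.forall, MulEquiv.ext_iff]
  exact forall_congr' fun g => smul_eq_iff_dihedralAction φ σ g

theorem smul_mk_eq_iff_dihedralAction (S : Subgroup A) [S.Normal] [IsGStable G S] (σ : G)
    (g : DihedralGroup n) :
    σ • (QuotientGroup.mk (φ g) : A ⧸ S) = QuotientGroup.mk (φ g) ↔
      φ (g⁻¹ * dihedralAction φ σ g) ∈ S := by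
  rw [IsGStable.smul_mk, eq_comm, QuotientGroup.eq, map_mul, map_inv, map_dihedralAction]

theorem forall_smul_mk_eq_iff_dihedralAction (S : Subgroup A) [S.Normal] [IsGStable G S]
    (σ : G) :
    (∀ x : A ⧸ S, σ • x = x) ↔ ∀ g, φ (g⁻¹ * dihedralAction φ σ g) ∈ S := by
  rw [QuotientGroup.mk_surjective.forall, φ.surjective.forall]
  exact forall_congr' fun g => smul_mk_eq_iff_dihedralAction φ S σ g

theorem map_mem_rotationSubgroup_iff (d : ℕ) (g : DihedralGroup n) :
    φ g ∈ rotationSubgroup φ d ↔ ∃ j : ZMod n, g = r ((d : ZMod n) * j) := by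
  have h : ∀ m : ℤ, (φ (r 1) ^ d) ^ m = φ (r ((d : ZMod n) * (m : ZMod n))) := fun m => by
    rw [← map_pow, ← map_zpow, r_one_pow, r_zpow]
  constructor
  · rintro ⟨m, hm⟩
    exact ⟨m, φ.injective (hm.symm.trans (h m))⟩
  · rintro ⟨j, rfl⟩
    obtain ⟨m, rfl⟩ := ZMod.intCast_surjective j
    exact ⟨m, h m⟩

theorem forall_rotation_smul_eq_iff [IsGStable G (rotationSubgroup φ 1)] (σ : G) :
    (∀ x : rotationSubgroup φ 1, σ • x = x) ↔ dihedralAction φ σ (r 1) = r 1 := by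
  have hmem : φ (r 1) ∈ rotationSubgroup φ 1 :=
    (map_mem_rotationSubgroup_iff φ 1 _).2 ⟨1, by simp⟩
  rw [← smul_eq_iff_dihedralAction]
  constructor
  · intro h
    exact congrArg Subtype.val (h ⟨_, hmem⟩)
  · rintro h ⟨x, m, rfl⟩
    apply Subtype.ext
    rw [IsGStable.coe_smul]
    change σ • ((φ (r 1) ^ 1) ^ m) = (φ (r 1) ^ 1) ^ m
    rw [pow_one, smul_zpow', h]

end DihedralAction

/-! ### The scalar matrix `-1` in a dihedral group of matrices -/

section Central

open Matrix

variable {Ω : Type*} [Field Ω]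

/-- The centralizer of a non-scalar `2 × 2` matrix is commutative. -/
theorem commute_of_commute_of_not_scalar {M P Q : Matrix (Fin 2) (Fin 2) Ω}
    (hM : ¬ (M 0 1 = 0 ∧ M 1 0 = 0 ∧ M 0 0 = M 1 1)) (hP : M * P = P * M) (hQ : M * Q = Q * M) :
    P * Q = Q * P := by
  -- `P` commutes with `M` iff the vectors `(M 0 1, M 1 0, M 0 0 - M 1 1)` and
  -- `(P 0 1, P 1 0, P 0 0 - P 1 1)` are proportional.
  have key : ∀ X Y : Matrix (Fin 2) (Fin 2) Ω, X * Y = Y * X ↔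
      X 0 1 * Y 1 0 = X 1 0 * Y 0 1 ∧
      X 0 1 * (Y 0 0 - Y 1 1) = (X 0 0 - X 1 1) * Y 0 1 ∧
      X 1 0 * (Y 0 0 - Y 1 1) = (X 0 0 - X 1 1) * Y 1 0 := by
    intro X Y
    rw [← Matrix.ext_iff]
    simp only [Fin.forall_fin_two, Matrix.mul_apply, Fin.sum_univ_two]
    constructor
    · rintro ⟨⟨h1, h2⟩, h3, h4⟩
      exact ⟨by linear_combination h1, by linear_combination -h2, by linear_combination h3⟩
    · rintro ⟨h1, h2, h3⟩
      exact ⟨⟨by linear_combination h1, by linear_combination -h2⟩,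
        by linear_combination h3, by linear_combination -h1⟩
  rw [key] at hP hQ ⊢
  obtain ⟨p1, p2, p3⟩ := hP
  obtain ⟨q1, q2, q3⟩ := hQ
  by_cases hb : M 0 1 = 0
  · by_cases hc : M 1 0 = 0
    · have he : M 0 0 - M 1 1 ≠ 0 := fun h => hM ⟨hb, hc, sub_eq_zero.1 h⟩
      rw [hb, zero_mul] at p2 q2
      rw [hc, zero_mul] at p3 q3
      have a1 := (mul_eq_zero.1 p2.symm).resolve_left he
      have a2 := (mul_eq_zero.1 q2.symm).resolve_left he
      have a3 := (mul_eq_zero.1 p3.symm).resolve_left he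
      have a4 := (mul_eq_zero.1 q3.symm).resolve_left he
      simp [a1, a2, a3, a4]
    · rw [hb, zero_mul] at p1 q1
      have a1 := (mul_eq_zero.1 p1.symm).resolve_left hc
      have a2 := (mul_eq_zero.1 q1.symm).resolve_left hc
      refine ⟨by simp [a1, a2], by simp [a1, a2], mul_left_cancel₀ hc ?_⟩
      linear_combination P 1 0 * q3 - Q 1 0 * p3
  · refine ⟨mul_left_cancel₀ hb ?_, mul_left_cancel₀ hb ?_,
      mul_left_cancel₀ (mul_ne_zero hb hb) ?_⟩
    · linear_combination P 0 1 * q1 - Q 0 1 * p1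
    · linear_combination P 0 1 * q2 - Q 0 1 * p2
    · linear_combination M 0 1 * (Q 0 0 - Q 1 1) * p1 + M 1 0 * P 0 1 * q2 -
        M 0 1 * (P 0 0 - P 1 1) * q1 - M 1 0 * Q 0 1 * p2

/-- A central involution in a nonabelian group of `2 × 2` matrices is `-1`. -/
theorem eq_neg_one_of_central {A : Subgroup (GL (Fin 2) Ω)} {z p q : A}
    (hz : ∀ a : A, z * a = a * z) (hzz : z * z = 1) (hz1 : z ≠ 1) (hpq : p * q ≠ q * p) :
    (z : GL (Fin 2) Ω) = -1 := by
  let ι : A →* Matrix (Fin 2) (Fin 2) Ω := (Units.coeHom _).comp A.subtype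
  have hι : Function.Injective ι := Units.val_injective.comp Subtype.val_injective
  have hcomm : ∀ a, ι z * ι a = ι a * ι z := fun a => by rw [← map_mul, hz, map_mul]
  obtain ⟨h1, h2, h3⟩ : ι z 0 1 = 0 ∧ ι z 1 0 = 0 ∧ ι z 0 0 = ι z 1 1 := by
    by_contra h
    apply hpq
    apply hι
    rw [map_mul, map_mul]
    exact commute_of_commute_of_not_scalar h (hcomm p) (hcomm q)
  have hsq : ι z * ι z = 1 := by rw [← map_mul, hzz, map_one]
  have h4 := congrFun (congrFun hsq 0) 0
  rw [Matrix.mul_apply, Fin.sum_univ_two, h1, zero_mul, add_zero, Matrix.one_apply_eq,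
    mul_self_eq_one_iff] at h4
  rcases h4 with h4 | h4
  · refine absurd (hι ?_) hz1
    rw [map_one]
    ext i j
    fin_cases i <;> fin_cases j <;> simp [h1, h2, h4, ← h3]
  · apply Units.ext
    change ι z = -1
    ext i j
    fin_cases i <;> fin_cases j <;> simp [h1, h2, h4, ← h3]

open DihedralGroup in
/-- The rotation of order two in a dihedral group of `2 × 2` matrices is `-1`. -/
theorem map_r_eq_neg_one {n : ℕ} (hn : 2 < n) {A : Subgroup (GL (Fin 2) Ω)}
    (φ : DihedralGroup n ≃* A) {h : ZMod n} (hh : h + h = 0) (h0 : h ≠ 0) :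
    (φ (r h) : GL (Fin 2) Ω) = -1 := by
  refine eq_neg_one_of_central (p := φ (sr 0)) (q := φ (r 1)) ?_ ?_ ?_ ?_
  · intro a
    obtain ⟨g, rfl⟩ := φ.surjective a
    rw [← map_mul, ← map_mul]
    congr 1
    rcases g with i | i
    · rw [r_mul_r, r_mul_r, add_comm]
    · rw [r_mul_sr, sr_mul_r, sr.injEq]
      linear_combination -hh
  · rw [← map_mul, r_mul_r, hh, r_zero, map_one]
  · rw [Ne, EmbeddingLike.map_eq_one_iff, one_def, r.injEq]
    exact h0
  · rw [← map_mul, ← map_mul, φ.injective.ne_iff, sr_mul_r, r_mul_sr, Ne, sr.injEq]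
    intro h
    apply two_ne_zero_zmod_of_two_lt hn
    linear_combination h

end Central

/-! ### The connecting homomorphism for a dihedral group -/

section ConnectingHom

open Matrix DihedralGroup

variable {k Ω : Type*} [Field k] [Field Ω] [Algebra k Ω] {n : ℕ}
  {A : Subgroup (GL (Fin 2) Ω)} [IsGStable Gal(Ω/k) A] (φ : DihedralGroup n ≃* A)

theorem map_mem_plusMinusOne_iff {h : ZMod n} (hneg : (φ (r h) : GL (Fin 2) Ω) = -1)
    (g : DihedralGroup n) :
    φ g ∈ (plusMinusOne Ω).subgroupOf A ↔ g = r 0 ∨ g = r h := by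
  rw [Subgroup.mem_subgroupOf, mem_plusMinusOne, ← hneg, ← Subtype.ext_iff, φ.injective.eq_iff,
    OneMemClass.coe_eq_one, EmbeddingLike.map_eq_one_iff, one_def]

theorem mk_mem_fixedPoints_iff {h : ZMod n} (hneg : (φ (r h) : GL (Fin 2) Ω) = -1)
    (g : DihedralGroup n) :
    (QuotientGroup.mk (φ g) : ReducedGroup A) ∈ FixedPoints.subgroup Gal(Ω/k) (ReducedGroup A) ↔
      ∀ σ : Gal(Ω/k), g⁻¹ * dihedralAction φ σ g = r 0 ∨ g⁻¹ * dihedralAction φ σ g = r h := by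
  rw [FixedPoints.mem_subgroup]
  exact forall_congr' fun σ => by
    rw [smul_mk_eq_iff_dihedralAction, map_mem_plusMinusOne_iff φ hneg]

theorem forall_reducedGroup_smul_eq_iff {h : ZMod n} (hneg : (φ (r h) : GL (Fin 2) Ω) = -1)
    (σ : Gal(Ω/k)) :
    (∀ x : ReducedGroup A, σ • x = x) ↔
      ∀ g, g⁻¹ * dihedralAction φ σ g = r 0 ∨ g⁻¹ * dihedralAction φ σ g = r h := by
  rw [forall_smul_mk_eq_iff_dihedralAction φ]
  exact forall_congr' fun g => map_mem_plusMinusOne_iff φ hneg _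

variable [Algebra.IsAlgebraic k Ω]

theorem signCharacter_connectingHom_eq_one_iff (g : DihedralGroup n)
    (h : (QuotientGroup.mk (φ g) : ReducedGroup A) ∈
      FixedPoints.subgroup Gal(Ω/k) (ReducedGroup A)) (σ : Gal(Ω/k)) :
    signCharacter (connectingHom A ⟨QuotientGroup.mk (φ g), h⟩) σ = 1 ↔
      dihedralAction φ σ g = g := by
  have h1 : connectingHom A ⟨QuotientGroup.mk (φ g), h⟩ =
      QuotientGroup.mk (connectingCocycle A (φ g) h) :=
    connectingCocycle_eq A _ _ _ _ (QuotientGroup.out_eq' _)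
  rw [h1, signCharacter_mk, ← smul_eq_iff_dihedralAction, Subtype.ext_iff, Subtype.ext_iff,
    eq_comm (b := (φ g : GL (Fin 2) Ω))]
  exact inv_mul_eq_one

/-- To bound the image of the connecting homomorphism it is enough to consider the elements of the
dihedral group whose classes modulo `±1` are invariant. -/
theorem range_connectingHom_le {D : Subgroup (contH1 Gal(Ω/k) (plusMinusOne Ω))}
    (hD : ∀ g h, connectingHom A ⟨QuotientGroup.mk (φ g), h⟩ ∈ D) :
    (connectingHom (k := k) A).range ≤ D := by
  rintro _ ⟨⟨x, hx⟩, rfl⟩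
  induction x using QuotientGroup.induction_on with | H a => ?_
  obtain ⟨g, rfl⟩ := φ.surjective a
  exact hD g hx

theorem isOpen_ker_of_dihedralAction [NeZero n] {X : Type*} [MulAction Gal(Ω/k) X]
    (h : ∀ σ : Gal(Ω/k), dihedralAction φ σ = 1 → ∀ x : X, σ • x = x) :
    IsOpen ((MulAction.toPermHom Gal(Ω/k) X).ker : Set Gal(Ω/k)) := by
  have : Finite A := Finite.of_equiv _ φ.toEquiv
  exact isOpen_ker_of_forall_smul_eq A fun σ hσ =>
    h σ ((forall_smul_eq_iff_dihedralAction φ σ).1 hσ)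

theorem finrank_fieldOfDefinition_eq_card_range [PerfectField k]
    [IsAlgClosure k Ω] [NeZero n] :
    Module.finrank k (fieldOfDefinition k Ω A) =
      Nat.card (dihedralAction (G := Gal(Ω/k)) φ).range := by
  rw [finrank_fieldOfDefinition A (isOpen_ker_of_dihedralAction φ fun σ =>
    (forall_smul_eq_iff_dihedralAction φ σ).2), ← Subgroup.index_ker, ← Subgroup.index_ker]
  congr 1
  ext σ
  rw [mem_ker_toPermHom_iff, forall_smul_eq_iff_dihedralAction φ, MonoidHom.mem_ker]

end ConnectingHom

/-! ### Reduced group of order four -/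

section OrderEight

open Matrix DihedralGroup

theorem zmod_four_units (u : (ZMod 4)ˣ) : (u : ZMod 4) = 1 ∨ (u : ZMod 4) = -1 := by
  revert u; decide

theorem exists_dihedralAut_four (F : MulAut (DihedralGroup 4)) :
    ∃ u c : ZMod 4, (u = 1 ∨ u = -1) ∧ (∀ i, F (r i) = r (u * i)) ∧
      ∀ i, F (sr i) = sr (c + u * i) := by
  obtain ⟨u, c, hr, hs⟩ := exists_dihedralAut_apply (by norm_num) F
  exact ⟨u, c, zmod_four_units u, hr, hs⟩

theorem dihedralAut_four_r (F : MulAut (DihedralGroup 4)) (i : ZMod 4) :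
    (r i)⁻¹ * F (r i) = r 0 ∨ (r i)⁻¹ * F (r i) = r 2 := by
  obtain ⟨u, c, hu, hr, -⟩ := exists_dihedralAut_four F
  rw [hr, inv_r, r_mul_r, r.injEq, r.injEq]
  rcases hu with rfl | rfl <;> revert i <;> decide

/-- If the class modulo the centre of one reflection is fixed, then so are all classes. -/
theorem dihedralAut_four_of_sr {F : MulAut (DihedralGroup 4)} {i : ZMod 4}
    (h : (sr i)⁻¹ * F (sr i) = r 0 ∨ (sr i)⁻¹ * F (sr i) = r 2) (g : DihedralGroup 4) :
    g⁻¹ * F g = r 0 ∨ g⁻¹ * F g = r 2 := by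
  rcases g with j | j
  · exact dihedralAut_four_r F j
  · obtain ⟨u, c, hu, -, hs⟩ := exists_dihedralAut_four F
    rw [hs, inv_sr, sr_mul_sr, r.injEq, r.injEq] at h ⊢
    clear hs
    revert u c i j; decide

variable {k Ω : Type*} [Field k] [Field Ω] [Algebra k Ω]
  {A : Subgroup (GL (Fin 2) Ω)} [IsGStable Gal(Ω/k) A]
  (φ : DihedralGroup 4 ≃* A)

theorem mk_r_mem_fixedPoints_four (i : ZMod 4) :
    (QuotientGroup.mk (φ (r i)) : ReducedGroup A) ∈
      FixedPoints.subgroup Gal(Ω/k) (ReducedGroup A) :=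
  (mk_mem_fixedPoints_iff φ (map_r_eq_neg_one (by norm_num) φ (by decide) (by decide)) _).2
    fun σ => dihedralAut_four_r _ i

variable [PerfectField k] [IsAlgClosure k Ω]

theorem fieldOfDefinition_rotationSubgroup_four_iff (h2 : ringChar k ≠ 2) (v : kˣ) :
    fieldOfDefinition k Ω (rotationSubgroup φ 1) = adjoinSqrt k Ω {v} ↔
      ∀ σ : Gal(Ω/k), dihedralAction φ σ (r 1) = r 1 ↔
        signCharacter (kummerClass k Ω v) σ = 1 := by
  rw [fieldOfDefinition_eq_adjoinSqrt_iff h2 (isOpen_ker_of_dihedralAction φ fun σ hσ =>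
    (forall_rotation_smul_eq_iff φ σ).2 (by rw [hσ]; rfl))]
  exact forall_congr' fun σ => by rw [forall_rotation_smul_eq_iff φ]; simp

theorem fieldOfDefinition_reducedGroup_four_iff (h2 : ringChar k ≠ 2) :
    fieldOfDefinition k Ω (ReducedGroup A) = ⊥ ↔
      ∀ (σ : Gal(Ω/k)) (g : DihedralGroup 4),
        g⁻¹ * dihedralAction φ σ g = r 0 ∨ g⁻¹ * dihedralAction φ σ g = r 2 := by
  have hneg : (φ (r 2) : GL (Fin 2) Ω) = -1 :=
    map_r_eq_neg_one (by norm_num) φ (by decide) (by decide)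
  rw [fieldOfDefinition_eq_bot_iff h2 (isOpen_ker_of_dihedralAction φ fun σ hσ =>
    (forall_reducedGroup_smul_eq_iff φ hneg σ).2 fun g => by rw [hσ]; simp)]
  exact forall_congr' fun σ => forall_reducedGroup_smul_eq_iff φ hneg σ

theorem fieldOfDefinition_eq_adjoinSqrt_pair_iff {n : ℕ} [NeZero n] (h2 : ringChar k ≠ 2)
    (φ : DihedralGroup n ≃* A) (v m : kˣ) :
    fieldOfDefinition k Ω A = adjoinSqrt k Ω {v, m} ↔
      ∀ σ : Gal(Ω/k), dihedralAction φ σ = 1 ↔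
        signCharacter (kummerClass k Ω v) σ = 1 ∧ signCharacter (kummerClass k Ω m) σ = 1 := by
  rw [fieldOfDefinition_eq_adjoinSqrt_iff h2 (isOpen_ker_of_dihedralAction φ fun σ =>
    (forall_smul_eq_iff_dihedralAction φ σ).2)]
  exact forall_congr' fun σ => by rw [forall_smul_eq_iff_dihedralAction φ]; simp

theorem range_connectingHom_of_reduced_trivial (φ : DihedralGroup 4 ≃* A)
    (h2 : ringChar k ≠ 2) {v m : kˣ}
    (hA' : fieldOfDefinition k Ω (ReducedGroup A) = ⊥)
    (hA : fieldOfDefinition k Ω A = adjoinSqrt k Ω {v, m}) :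
    (connectingHom (k := k) A).range = Subgroup.closure (kummerClass k Ω '' {v, m}) := by
  have hneg : (φ (r 2) : GL (Fin 2) Ω) = -1 :=
    map_r_eq_neg_one (by norm_num) φ (by decide) (by decide)
  rw [fieldOfDefinition_reducedGroup_four_iff φ h2] at hA'
  rw [fieldOfDefinition_eq_adjoinSqrt_pair_iff h2 φ] at hA
  have hfix : ∀ g, (QuotientGroup.mk (φ g) : ReducedGroup A) ∈
      FixedPoints.subgroup Gal(Ω/k) (ReducedGroup A) := fun g =>
    (mk_mem_fixedPoints_iff φ hneg g).2 fun σ => hA' σ g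
  rw [Set.image_pair]
  apply le_antisymm
  · refine range_connectingHom_le φ fun g h => mem_closure_pair_of_signCharacter fun σ hv hm => ?_
    rw [signCharacter_connectingHom_eq_one_iff, (hA σ).2 ⟨hv, hm⟩]
    rfl
  · -- An element acts trivially on `A` as soon as it fixes `r 1` and `sr 0`.
    have hle : Subgroup.closure {connectingHom A ⟨_, hfix (r 1)⟩,
        connectingHom A ⟨_, hfix (sr 0)⟩} ≤ (connectingHom (k := k) A).range := by
      rw [Subgroup.closure_le]
      rintro _ (rfl | rfl) <;> exact ⟨_, rfl⟩
    have htriv : ∀ σ, signCharacter (connectingHom (k := k) A ⟨_, hfix (r 1)⟩) σ = 1 →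
        signCharacter (connectingHom (k := k) A ⟨_, hfix (sr 0)⟩) σ = 1 →
        dihedralAction φ σ = 1 := fun σ h1 h0 =>
      dihedralAut_eq_one ((signCharacter_connectingHom_eq_one_iff φ _ _ σ).1 h1)
        ((signCharacter_connectingHom_eq_one_iff φ _ _ σ).1 h0)
    rw [Subgroup.closure_le]
    rintro _ (rfl | rfl)
    · exact hle (mem_closure_pair_of_signCharacter fun σ h1 h0 => ((hA σ).1 (htriv σ h1 h0)).1)
    · exact hle (mem_closure_pair_of_signCharacter fun σ h1 h0 => ((hA σ).1 (htriv σ h1 h0)).2)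

theorem range_connectingHom_of_reduced_nontrivial (h2 : ringChar k ≠ 2) {v : kˣ}
    (hv : fieldOfDefinition k Ω (rotationSubgroup φ 1) = adjoinSqrt k Ω {v})
    (hA' : fieldOfDefinition k Ω (ReducedGroup A) ≠ ⊥) :
    (connectingHom (k := k) A).range = Subgroup.closure (kummerClass k Ω '' {v}) := by
  have hneg : (φ (r 2) : GL (Fin 2) Ω) = -1 :=
    map_r_eq_neg_one (by norm_num) φ (by decide) (by decide)
  rw [Ne, fieldOfDefinition_reducedGroup_four_iff φ h2] at hA'
  rw [fieldOfDefinition_rotationSubgroup_four_iff φ h2] at hv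
  rw [Set.image_singleton]
  apply le_antisymm
  · refine range_connectingHom_le φ fun g h => mem_closure_singleton_of_signCharacter fun σ h1 => ?_
    rw [signCharacter_connectingHom_eq_one_iff]
    rcases g with i | i
    · obtain ⟨m, rfl⟩ := ZMod.intCast_surjective i
      rw [← r_one_zpow, map_zpow, (hv σ).2 h1]
    · rw [mk_mem_fixedPoints_iff φ hneg] at h
      exact absurd (fun τ g => dihedralAut_four_of_sr (h τ) g) hA'
  · have h1 : kummerClass k Ω v ∈
        Subgroup.closure {connectingHom A ⟨_, mk_r_mem_fixedPoints_four (k := k) φ 1⟩} :=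
      mem_closure_singleton_of_signCharacter fun σ hσ =>
        (hv σ).1 ((signCharacter_connectingHom_eq_one_iff φ _ _ σ).1 hσ)
    rw [Subgroup.closure_le, Set.singleton_subset_iff]
    exact (Subgroup.closure_le _).2 (by rintro _ rfl; exact ⟨_, rfl⟩) h1

theorem exists_fieldOfDefinition_rotationSubgroup_four (h2 : ringChar k ≠ 2) :
    ∃ v : kˣ, fieldOfDefinition k Ω (rotationSubgroup φ 1) = adjoinSqrt k Ω {v} := by
  obtain ⟨v, hv⟩ := kummerHom_surjective h2
    (connectingHom A ⟨_, mk_r_mem_fixedPoints_four (k := k) φ 1⟩)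
  refine ⟨v, (fieldOfDefinition_rotationSubgroup_four_iff φ h2 v).2 fun σ => ?_⟩
  rw [← kummerHom_apply h2, hv, signCharacter_connectingHom_eq_one_iff]

theorem exists_fieldOfDefinition_four (h2 : ringChar k ≠ 2) {v : kˣ}
    (hv : fieldOfDefinition k Ω (rotationSubgroup φ 1) = adjoinSqrt k Ω {v})
    (hA' : fieldOfDefinition k Ω (ReducedGroup A) = ⊥) :
    ∃ m : kˣ, fieldOfDefinition k Ω A = adjoinSqrt k Ω {v, m} := by
  have hneg : (φ (r 2) : GL (Fin 2) Ω) = -1 :=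
    map_r_eq_neg_one (by norm_num) φ (by decide) (by decide)
  rw [fieldOfDefinition_reducedGroup_four_iff φ h2] at hA'
  rw [fieldOfDefinition_rotationSubgroup_four_iff φ h2] at hv
  obtain ⟨m, hm⟩ := kummerHom_surjective h2
    (connectingHom A ⟨_, (mk_mem_fixedPoints_iff φ hneg (sr 0)).2 fun σ => hA' σ _⟩)
  refine ⟨m, (fieldOfDefinition_eq_adjoinSqrt_pair_iff h2 φ v m).2 fun σ => ?_⟩
  rw [← kummerHom_apply h2 m, hm, signCharacter_connectingHom_eq_one_iff, ← hv]
  exact ⟨fun h => by rw [h]; exact ⟨rfl, rfl⟩, fun h => dihedralAut_eq_one h.1 h.2⟩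

end OrderEight

/-! ### Reduced group of order six -/

section OrderTwelve

open Matrix DihedralGroup

theorem zmod_six_units (u : (ZMod 6)ˣ) : (u : ZMod 6) = 1 ∨ (u : ZMod 6) = -1 := by
  revert u; decide

theorem exists_dihedralAut_six (F : MulAut (DihedralGroup 6)) :
    ∃ u c : ZMod 6, (u = 1 ∨ u = -1) ∧ (∀ i, F (r i) = r (u * i)) ∧
      ∀ i, F (sr i) = sr (c + u * i) := by
  obtain ⟨u, c, hr, hs⟩ := exists_dihedralAut_apply (by norm_num) F
  exact ⟨u, c, zmod_six_units u, hr, hs⟩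

/-- The effect of an automorphism on the quotient by `⟨r 2⟩` is seen on any single reflection. -/
theorem dihedralAut_six_quotient_iff (F : MulAut (DihedralGroup 6)) (i : ZMod 6) :
    (∀ g, ∃ j : ZMod 6, g⁻¹ * F g = r (2 * j)) ↔ ∃ j : ZMod 6, (sr i)⁻¹ * F (sr i) = r (2 * j) := by
  refine ⟨fun h => h _, fun h g => ?_⟩
  obtain ⟨u, c, hu, hr, hs⟩ := exists_dihedralAut_six F
  rcases g with l | l
  · simp only [hr, inv_r, r_mul_r, r.injEq]
    clear hr hs h
    revert u l; decide
  · simp only [hs, inv_sr, sr_mul_sr, r.injEq] at h ⊢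
    clear hr hs
    revert u c i l; decide

/-- A rotation fixed modulo the centre is fixed: it is, up to the centre, of odd order. -/
theorem dihedralAut_six_r {F : MulAut (DihedralGroup 6)} {i : ZMod 6}
    (h : (r i)⁻¹ * F (r i) = r 0 ∨ (r i)⁻¹ * F (r i) = r 3) : F (r i) = r i := by
  obtain ⟨u, c, hu, hr, -⟩ := exists_dihedralAut_six F
  simp only [hr, inv_r, r_mul_r, r.injEq] at h ⊢
  clear hr
  revert u i; decide

/-- The order of a group of automorphisms of the dihedral group of order twelve is divisible by
three iff the group contains an automorphism that is trivial on rotations and moves the reflection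
`sr 0` modulo the centre. -/
theorem three_dvd_card_range_iff {G : Type*} [Group G] (f : G →* MulAut (DihedralGroup 6)) :
    3 ∣ Nat.card f.range ↔
      ∃ σ, f σ (r 1) = r 1 ∧ ¬ ((sr 0)⁻¹ * f σ (sr 0) = r 0 ∨ (sr 0)⁻¹ * f σ (sr 0) = r 3) := by
  have hfin : Finite (MulAut (DihedralGroup 6)) :=
    Finite.of_injective (fun F : MulAut (DihedralGroup 6) => (F : DihedralGroup 6 → _))
      DFunLike.coe_injective
  constructor
  · intro h
    have : Fact (Nat.Prime 3) := ⟨Nat.prime_three⟩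
    obtain ⟨⟨_, σ, rfl⟩, hσ⟩ := exists_prime_orderOf_dvd_card' 3 h
    replace hσ : orderOf (f σ) = 3 := (Subgroup.orderOf_coe _).trans hσ
    have h3 : f σ ^ 3 = 1 := by rw [← hσ, pow_orderOf_eq_one]
    have h1 : f σ ≠ 1 := fun e => by rw [e, orderOf_one] at hσ; omega
    obtain ⟨u, c, hu, hr, hs⟩ := exists_dihedralAut_six (f σ)
    have hr3 := DFunLike.congr_fun h3 (r 1)
    have hs3 := DFunLike.congr_fun h3 (sr 0)
    simp only [pow_succ, pow_zero, one_mul, MulAut.mul_apply, MulAut.one_apply, hr, hs, r.injEq,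
      sr.injEq] at hr3 hs3
    have h0 : ¬ (u = 1 ∧ c = 0) := by
      rintro ⟨rfl, rfl⟩
      exact h1 (dihedralAut_eq_one (by simp [hr]) (by simp [hs]))
    refine ⟨σ, ?_⟩
    simp only [hr, hs, inv_sr, sr_mul_sr, r.injEq]
    clear hr hs
    revert u c; decide
  · rintro ⟨σ, hσ1, hσ0⟩
    obtain ⟨u, c, hu, hr, hs⟩ := exists_dihedralAut_six (f σ)
    have hu1 : u = 1 := by simpa [hr] using hσ1
    subst hu1
    simp only [hs, inv_sr, sr_mul_sr, r.injEq] at hσ0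
    have hpow : ∀ N : ℕ, (f σ ^ N) (sr 0) = sr ((N : ZMod 6) * c) := by
      intro N
      induction N with
      | zero => simp
      | succ N ih =>
        rw [pow_succ', MulAut.mul_apply, ih, hs, sr.injEq]
        push_cast
        ring
    have hcard : f σ ^ Nat.card f.range = 1 :=
      congrArg Subtype.val (pow_card_eq_one' (x := (⟨f σ, σ, rfl⟩ : f.range)))
    have h := hpow (Nat.card f.range)
    rw [hcard, MulAut.one_apply, sr.injEq] at h
    -- As `c` is not divisible by three, the relation `N * c = 0` modulo six forces `2 * N = 0`.
    have key : ∀ x c : ZMod 6, ¬ (c + 1 * 0 - 0 = 0 ∨ c + 1 * 0 - 0 = 3) → 0 = x * c →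
        2 * x = 0 := by decide
    have h6 : ((2 * Nat.card f.range : ℕ) : ZMod 6) = 0 := by
      push_cast
      exact key _ c hσ0 h
    rw [ZMod.natCast_eq_zero_iff] at h6
    omega

/-- If three does not divide the order of a group acting on the dihedral group of order twelve,
then some reflection is fixed modulo the centre. -/
theorem exists_sr_fixed_of_not_three_dvd {G : Type*} [Group G]
    (f : G →* MulAut (DihedralGroup 6)) (h : ¬ 3 ∣ Nat.card f.range) :
    ∃ i, ∀ σ, (sr i)⁻¹ * f σ (sr i) = r 0 ∨ (sr i)⁻¹ * f σ (sr i) = r 3 := by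
  rw [three_dvd_card_range_iff] at h
  replace h := fun σ h1 => not_not.1 fun h0 => h ⟨σ, h1, h0⟩
  by_cases hall : ∀ σ, f σ (r 1) = r 1
  · exact ⟨0, fun σ => h σ (hall σ)⟩
  · push Not at hall
    obtain ⟨τ, hτ⟩ := hall
    obtain ⟨ut, ct, hut, hrt, hst⟩ := exists_dihedralAut_six (f τ)
    have hut' : ut = -1 := hut.resolve_left fun e => hτ (by rw [hrt, e, one_mul])
    subst hut'
    -- `τ` inverts rotations, so it fixes modulo the centre the reflection at the midpoint
    -- `ct / 2` of `0` and `ct` modulo three, and `1 / 2 = 2` there.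
    refine ⟨2 * ct, fun σ => ?_⟩
    obtain ⟨u, c, hu, hr, hs⟩ := exists_dihedralAut_six (f σ)
    have h1 := h σ
    have h2 := h (τ * σ)
    simp only [map_mul, MulAut.mul_apply, hrt, hst, hr, hs, inv_sr, sr_mul_sr, r.injEq] at h1 h2 ⊢
    clear hr hs hrt hst hτ
    revert u c ct; decide

variable {k Ω : Type*} [Field k] [Field Ω] [Algebra k Ω]
  {A : Subgroup (GL (Fin 2) Ω)} [IsGStable Gal(Ω/k) A] (φ : DihedralGroup 6 ≃* A)

theorem forall_quotient_rotationSubgroup_smul_eq_iff (σ : Gal(Ω/k)) :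
    (∀ x : A ⧸ rotationSubgroup φ 2, σ • x = x) ↔
      ∀ g, ∃ j : ZMod 6, g⁻¹ * dihedralAction φ σ g = r (2 * j) := by
  rw [forall_smul_mk_eq_iff_dihedralAction φ]
  exact forall_congr' fun g => by rw [map_mem_rotationSubgroup_iff, Nat.cast_ofNat]

variable [IsAlgClosure k Ω]

theorem isOpen_ker_quotient_rotationSubgroup :
    IsOpen ((MulAction.toPermHom Gal(Ω/k) (A ⧸ rotationSubgroup φ 2)).ker : Set Gal(Ω/k)) :=
  isOpen_ker_of_dihedralAction φ fun σ hσ => by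
    rw [forall_smul_mk_eq_iff_dihedralAction φ, hσ]
    intro g
    simp [one_mem]

variable [PerfectField k]

theorem fieldOfDefinition_quotient_rotationSubgroup_iff (h2 : ringChar k ≠ 2) (u : kˣ) :
    fieldOfDefinition k Ω (A ⧸ rotationSubgroup φ 2) = adjoinSqrt k Ω {u} ↔
      ∀ σ : Gal(Ω/k), (∀ g, ∃ j : ZMod 6, g⁻¹ * dihedralAction φ σ g = r (2 * j)) ↔
        signCharacter (kummerClass k Ω u) σ = 1 := by
  rw [fieldOfDefinition_eq_adjoinSqrt_iff h2 (isOpen_ker_quotient_rotationSubgroup φ)]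
  exact forall_congr' fun σ => by
    rw [forall_quotient_rotationSubgroup_smul_eq_iff φ]; simp

theorem exists_fieldOfDefinition_quotient_rotationSubgroup (h2 : ringChar k ≠ 2) :
    ∃ u : kˣ, fieldOfDefinition k Ω (A ⧸ rotationSubgroup φ 2) = adjoinSqrt k Ω {u} := by
  obtain ⟨u, hu⟩ := exists_kummerClass_eq_one_iff_mem h2
    (MulAction.toPermHom Gal(Ω/k) (A ⧸ rotationSubgroup φ 2)).ker
    (isOpen_ker_quotient_rotationSubgroup φ) fun σ τ hσ hτ => by
      -- Acting nontrivially on the quotient means shifting `sr 0` by an odd rotation.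
      rw [mem_ker_toPermHom_iff, forall_quotient_rotationSubgroup_smul_eq_iff,
        dihedralAut_six_quotient_iff _ 0] at hσ hτ ⊢
      obtain ⟨u, c, hu, hr, hs⟩ := exists_dihedralAut_six (dihedralAction φ σ)
      obtain ⟨u', c', hu', hr', hs'⟩ := exists_dihedralAut_six (dihedralAction φ τ)
      simp only [map_mul, MulAut.mul_apply, hs, hs', inv_sr, sr_mul_sr, r.injEq] at hσ hτ ⊢
      clear hr hr' hs hs'
      revert u c u' c'; decide
  refine ⟨u, (fieldOfDefinition_quotient_rotationSubgroup_iff φ h2 u).2 fun σ => ?_⟩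
  rw [hu, mem_ker_toPermHom_iff, forall_quotient_rotationSubgroup_smul_eq_iff φ]

theorem range_connectingHom_of_not_three_dvd (h2 : ringChar k ≠ 2)
    (h3 : ¬ 3 ∣ Module.finrank k (fieldOfDefinition k Ω A)) {u : kˣ}
    (hu : fieldOfDefinition k Ω (A ⧸ rotationSubgroup φ 2) = adjoinSqrt k Ω {u}) :
    (connectingHom (k := k) A).range = Subgroup.closure (kummerClass k Ω '' {u}) := by
  have hneg : (φ (r 3) : GL (Fin 2) Ω) = -1 :=
    map_r_eq_neg_one (by norm_num) φ (by decide) (by decide)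
  rw [finrank_fieldOfDefinition_eq_card_range φ] at h3
  rw [fieldOfDefinition_quotient_rotationSubgroup_iff φ h2] at hu
  obtain ⟨i, hi⟩ := exists_sr_fixed_of_not_three_dvd _ h3
  rw [Set.image_singleton]
  apply le_antisymm
  · refine range_connectingHom_le φ fun g h => mem_closure_singleton_of_signCharacter fun σ h1 => ?_
    rw [signCharacter_connectingHom_eq_one_iff]
    rcases (mk_mem_fixedPoints_iff φ hneg g).1 h σ with e | e
    · rw [r_zero, inv_mul_eq_one] at e
      exact e.symm
    · -- The element `-1 = r 3` is nontrivial in the quotient by `⟨r 2⟩`.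
      obtain ⟨j, hj⟩ := (hu σ).2 h1 g
      rw [e, r.injEq] at hj
      exfalso
      revert j; decide
  · have hfix := (mk_mem_fixedPoints_iff (k := k) φ hneg (sr i)).2 hi
    have h1 : kummerClass k Ω u ∈ Subgroup.closure {connectingHom A ⟨_, hfix⟩} :=
      mem_closure_singleton_of_signCharacter fun σ hσ => by
        rw [signCharacter_connectingHom_eq_one_iff] at hσ
        exact (hu σ).1 ((dihedralAut_six_quotient_iff _ i).2 ⟨0, by simp [hσ]⟩)
    rw [Subgroup.closure_le, Set.singleton_subset_iff]
    exact (Subgroup.closure_le _).2 (by rintro _ rfl; exact ⟨_, rfl⟩) h1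

theorem range_connectingHom_of_three_dvd (φ : DihedralGroup 6 ≃* A)
    (h3 : 3 ∣ Module.finrank k (fieldOfDefinition k Ω A)) :
    (connectingHom (k := k) A).range = Subgroup.closure (kummerClass k Ω '' ∅) := by
  have hneg : (φ (r 3) : GL (Fin 2) Ω) = -1 :=
    map_r_eq_neg_one (by norm_num) φ (by decide) (by decide)
  rw [finrank_fieldOfDefinition_eq_card_range φ, three_dvd_card_range_iff] at h3
  obtain ⟨τ, hτ1, hτ0⟩ := h3
  rw [Set.image_empty, Subgroup.closure_empty, eq_bot_iff]
  refine range_connectingHom_le φ fun g h => ?_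
  rw [Subgroup.mem_bot]
  apply signCharacter_injective
  ext1 σ
  rw [map_one, MonoidHom.one_apply, signCharacter_connectingHom_eq_one_iff]
  rw [mk_mem_fixedPoints_iff φ hneg] at h
  rcases g with i | i
  · exact dihedralAut_six_r (h σ)
  · -- No reflection is fixed modulo the centre by `τ`.
    exfalso
    obtain ⟨u, c, -, hr, hs⟩ := exists_dihedralAut_six (dihedralAction φ τ)
    have hi := h τ
    have hu1 : u = 1 := by simpa [hr] using hτ1
    subst hu1
    simp only [hs, inv_sr, sr_mul_sr, r.injEq] at hi hτ0
    simp_all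

end OrderTwelve

theorem mainTheorem12 {k Ω : Type*} [Field k] [PerfectField k] [Field Ω] [Algebra k Ω]
    [IsAlgClosure k Ω] (h2 : ringChar k ≠ 2) :
    (∀ (A : Subgroup (Matrix.GeneralLinearGroup (Fin 2) Ω)) [IsGStable Gal(Ω/k) A]
      (φ : DihedralGroup 4 ≃* A),
      (∃ v : kˣ, fieldOfDefinition k Ω (rotationSubgroup φ 1) = adjoinSqrt k Ω {v}) ∧
      ∀ v : kˣ, fieldOfDefinition k Ω (rotationSubgroup φ 1) = adjoinSqrt k Ω {v} →
        (fieldOfDefinition k Ω (ReducedGroup A) = ⊥ →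
          (∃ m : kˣ, fieldOfDefinition k Ω A = adjoinSqrt k Ω {v, m}) ∧
          ∀ m : kˣ, fieldOfDefinition k Ω A = adjoinSqrt k Ω {v, m} →
            ∃ e : kˣ ⧸ squaresAnd {v, m} ≃* HyperellipticTwists k A,
              ∀ a : kˣ, e (QuotientGroup.mk a) = QuotientGroup.mk (kummerClass k Ω a)) ∧
        (fieldOfDefinition k Ω (ReducedGroup A) ≠ ⊥ →
          ∃ e : kˣ ⧸ squaresAnd {v} ≃* HyperellipticTwists k A,
            ∀ a : kˣ, e (QuotientGroup.mk a) = QuotientGroup.mk (kummerClass k Ω a))) ∧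
    (ringChar k ≠ 3 →
      ∀ (A : Subgroup (Matrix.GeneralLinearGroup (Fin 2) Ω)) [IsGStable Gal(Ω/k) A]
      (φ : DihedralGroup 6 ≃* A),
      (∃ u : kˣ, fieldOfDefinition k Ω (A ⧸ rotationSubgroup φ 2) = adjoinSqrt k Ω {u}) ∧
      (¬ 3 ∣ Module.finrank k (fieldOfDefinition k Ω A) →
        ∀ u : kˣ, fieldOfDefinition k Ω (A ⧸ rotationSubgroup φ 2) = adjoinSqrt k Ω {u} →
          ∃ e : kˣ ⧸ squaresAnd {u} ≃* HyperellipticTwists k A,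
            ∀ a : kˣ, e (QuotientGroup.mk a) = QuotientGroup.mk (kummerClass k Ω a)) ∧
      (3 ∣ Module.finrank k (fieldOfDefinition k Ω A) →
        ∃ e : kˣ ⧸ squaresAnd (∅ : Set kˣ) ≃* HyperellipticTwists k A,
          ∀ a : kˣ, e (QuotientGroup.mk a) = QuotientGroup.mk (kummerClass k Ω a))) := by
  refine ⟨fun A _ φ => ⟨exists_fieldOfDefinition_rotationSubgroup_four φ h2, fun v hv =>
      ⟨fun hA' => ⟨exists_fieldOfDefinition_four φ h2 hv hA', fun m hm => ?_⟩, fun hA' => ?_⟩⟩,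
    fun _ A _ φ => ⟨exists_fieldOfDefinition_quotient_rotationSubgroup φ h2,
      fun h3 u hu => ?_, fun h3 => ?_⟩⟩
  · exact exists_mulEquiv_hyperellipticTwists h2 A
      (range_connectingHom_of_reduced_trivial φ h2 hA' hm)
  · exact exists_mulEquiv_hyperellipticTwists h2 A
      (range_connectingHom_of_reduced_nontrivial φ h2 hv hA')
  · exact exists_mulEquiv_hyperellipticTwists h2 A
      (range_connectingHom_of_not_three_dvd φ h2 h3 hu)
  · exact exists_mulEquiv_hyperellipticTwists h2 A (range_connectingHom_of_three_dvd φ h3)
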